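/- **Theorem (Brenner–Butler for finitely presented functors).** For a skeletally small additive category $\mathcal{X}$ let $\mathrm{Mod}(\mathcal{X})$ be the category of additive contravariant functors from $\mathcal{X}$ to abelian groups, and let $\mathrm{mod}(\mathcal{X})$ be its full subcategory of finitely presented functors, i.e. those $M$ with an exact sequence $\mathcal{X}(-,X_1)\to\mathcal{X}(-,X_0)\to M\to 0$. One says that $\mathcal{X}$ has pseudokernels if for every $f:X_1\to X_0$ there is $g:X_2\to X_1$ such that $\mathcal{X}(-,X_2)\to\mathcal{X}(-,X_1)\to\mathcal{X}(-,X_0)$ is exact. Let $\mathcal{C}$ be a skeletally small additive category, and let $\mathcal{T}$ be a skeletally small full additive subcategory of $\mathrm{Mod}(\mathcal{C})$ (that is, one with finite direct sums) which is a tilting subcategory of $\mathrm{mod}(\mathcal{C})$: every $T\in\mathcal{T}$ is finitely presented with $\mathrm{pdim}\,T\le 1$; $\mathrm{Ext}^1_{\mathcal{C}}(T,T')=0$ for all $T,T'\in\mathcal{T}$; and for every object $C$ of $\mathcal{C}$ there is an exact sequence $0\to\mathcal{C}(-,C)\to T_1\to T_2\to 0$ with $T_1,T_2\in\mathcal{T}$.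 Assume that $\mathcal{C}$ and $\mathcal{T}$ have pseudokernels. Define $F,F':\mathrm{Mod}(\mathcal{C})\to\mathrm{Mod}(\mathcal{T})$ by $F(M)=\mathrm{Hom}_{\mathcal{C}}(-,M)|_{\mathcal{T}}$ and $F'(M)=\mathrm{Ext}^1_{\mathcal{C}}(-,M)|_{\mathcal{T}}$, let $G=-\otimes\mathcal{T}:\mathrm{Mod}(\mathcal{T})\to\mathrm{Mod}(\mathcal{C})$ be the left adjoint of $F$, and let $G'=\mathrm{Tor}_1^{\mathcal{T}}(-,\mathcal{T})$ be the first left derived functor of $G$. Let $\mathscr{T}\subseteq\mathrm{Mod}(\mathcal{C})$ be the class of epimorphic images of arbitrary direct sums of objects of $\mathcal{T}$, let $\mathscr{F}=\{N\in\mathrm{Mod}(\mathcal{C}) : \mathrm{Hom}(M,N)=0 \text{ for all } M\in\mathscr{T}\}$, and let $\mathscr{X}=\{N\in\mathrm{Mod}(\mathcal{T}) : G(N)=0\}$, $\mathscr{Y}=\{N\in\mathrm{Mod}(\mathcal{T}) : G'(N)=0\}$. Put $\tilde{\mathscr{T}}=\mathscr{T}\cap\mathrm{mod}(\mathcal{C})$,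 $\tilde{\mathscr{F}}=\mathscr{F}\cap\mathrm{mod}(\mathcal{C})$, $\tilde{\mathscr{X}}=\mathscr{X}\cap\mathrm{mod}(\mathcal{T})$, $\tilde{\mathscr{Y}}=\mathscr{Y}\cap\mathrm{mod}(\mathcal{T})$. Then: 0. $F$ and $F'$ map $\mathrm{mod}(\mathcal{C})$ into $\mathrm{mod}(\mathcal{T})$, and $G$ and $G'$ map $\mathrm{mod}(\mathcal{T})$ into $\mathrm{mod}(\mathcal{C})$. 1. $F$ and $G$ restrict to mutually quasi-inverse equivalences between $\tilde{\mathscr{T}}$ and $\tilde{\mathscr{Y}}$. 2. $F'$ and $G'$ restrict to mutually quasi-inverse equivalences between $\tilde{\mathscr{F}}$ and $\tilde{\mathscr{X}}$. 3. $FG'=F'G=0$ and $G'F=GF'=0$. -/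

import Mathlib

open CategoryTheory CategoryTheory.Limits

universe w u

noncomputable section

namespace FunctorTilting

section ModuleCategory

variable (X : Type u) [Category.{w} X] [Preadditive X]

/-- The category `Mod(X)` of additive contravariant functors from the preadditive category `X`
to abelian groups. -/
abbrev FMod : Type (max u (w + 1)) := Xᵒᵖ ⥤+ AddCommGrpCat.{w}

instance closedUnderColimits (J : Type*) [Category* J] [HasColimitsOfShape J AddCommGrpCat.{w}] :
    (additiveFunctor Xᵒᵖ AddCommGrpCat.{w}).IsClosedUnderColimitsOfShape J where
  colimitsOfShape_le := by
    rintro F ⟨p⟩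
    have hp := p.prop_diag_obj
    refine ⟨fun {A B f g} ↦ ?_⟩
    refine (isColimitOfPreserves ((evaluation _ _).obj A) p.isColimit).hom_ext fun j ↦ ?_
    have : (p.diag.obj j).Additive := hp j
    have h : ∀ k : A ⟶ B, (p.ι.app j).app A ≫ F.map k = (p.diag.obj j).map k ≫ (p.ι.app j).app B :=
      fun k ↦ ((p.ι.app j).naturality k).symm
    change (p.ι.app j).app A ≫ F.map (f + g) = (p.ι.app j).app A ≫ (F.map f + F.map g)
    rw [Preadditive.comp_add, h, h, h, Functor.map_add, Preadditive.add_comp]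

instance closedUnderLimits (J : Type*) [Category* J] [HasLimitsOfShape J AddCommGrpCat.{w}] :
    (additiveFunctor Xᵒᵖ AddCommGrpCat.{w}).IsClosedUnderLimitsOfShape J where
  limitsOfShape_le := by
    rintro F ⟨p⟩
    have hp := p.prop_diag_obj
    refine ⟨fun {A B f g} ↦ ?_⟩
    refine (isLimitOfPreserves ((evaluation _ _).obj B) p.isLimit).hom_ext fun j ↦ ?_
    have : (p.diag.obj j).Additive := hp j
    have h : ∀ k : A ⟶ B, F.map k ≫ (p.π.app j).app B = (p.π.app j).app A ≫ (p.diag.obj j).map k :=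
      fun k ↦ (p.π.app j).naturality k
    change F.map (f + g) ≫ (p.π.app j).app B = (F.map f + F.map g) ≫ (p.π.app j).app B
    rw [Preadditive.add_comp, h, h, h, Functor.map_add, Preadditive.comp_add]

instance closedUnderKernels : (additiveFunctor Xᵒᵖ AddCommGrpCat.{w}).IsClosedUnderKernels where
  kernels_le := by
    rintro _ ⟨f, k, hk, hf⟩
    refine ObjectProperty.prop_of_isLimit _ hk ?_
    rintro (_ | _)
    exacts [hf.1, hf.2]

instance closedUnderCokernels :
    (additiveFunctor Xᵒᵖ AddCommGrpCat.{w}).IsClosedUnderCokernels where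
  cokernels_le := by
    rintro _ ⟨f, k, hk, hf⟩
    refine ObjectProperty.prop_of_isColimit _ hk ?_
    rintro (_ | _)
    exacts [hf.1, hf.2]

instance closedUnderFiniteProducts :
    (additiveFunctor Xᵒᵖ AddCommGrpCat.{w}).IsClosedUnderFiniteProducts where
  isClosedUnderLimitsOfShape _ _ := inferInstance

instance abelianMod : Abelian (FMod.{w} X) := inferInstance
instance hasColimitsMod : HasColimitsOfSize.{w, w} (FMod.{w} X) := ⟨fun _ _ ↦ inferInstance⟩

variable {X}

/-- The functor `P : X ⥤ Mod(X)`, `P(x) = X( , x)`. -/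
def rep : X ⥤ FMod.{w} X :=
  (additiveFunctor _ _).lift preadditiveYoneda fun _ ↦
    inferInstanceAs (Functor.Additive (preadditiveYoneda.obj _))

/-- The morphism `X( , x) ⟶ M` that corresponds to an element of `M(x)`. -/
def repLift {x : X} {M : FMod.{w} X} (a : M.obj.obj (.op x)) : rep.obj x ⟶ M :=
  ObjectProperty.homMk
    { app Y := AddCommGrpCat.ofHom
        (AddMonoidHom.mk' (fun g : Y.unop ⟶ x ↦ M.obj.map (Quiver.Hom.op g) a)
          fun (g h : Y.unop ⟶ x) ↦
            ConcreteCategory.congr_hom (M.obj.map_add (f := g.op) (g := h.op)) a)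
      naturality Y Z f := by
        ext (g : Y.unop ⟶ x)
        change M.obj.map (f.unop ≫ g).op a = M.obj.map f (M.obj.map g.op a)
        rw [op_comp, M.obj.map_comp]; rfl }

/-- The element of `M(x)` that corresponds to a morphism `X( , x) ⟶ M`. -/
def repElt {x : X} {M : FMod.{w} X} (f : rep.obj x ⟶ M) : M.obj.obj (.op x) :=
  f.hom.app (.op x) (𝟙 x : x ⟶ x)

lemma repElt_comp {x : X} {M N : FMod.{w} X} (f : rep.obj x ⟶ M) (g : M ⟶ N) :
    repElt (f ≫ g) = g.hom.app (.op x) (repElt f) := rfl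

lemma repElt_repLift {x : X} {M : FMod.{w} X} (a : M.obj.obj (.op x)) :
    repElt (repLift a) = a := by
  change M.obj.map (𝟙 x : x ⟶ x).op a = a
  rw [op_id, M.obj.map_id]; rfl

lemma repElt_injective {x : X} {M : FMod.{w} X} :
    Function.Injective (repElt : (rep.obj x ⟶ M) → M.obj.obj (.op x)) := by
  intro f g h
  ext Y (k : Y.unop ⟶ x)
  have key : ∀ f : rep.obj x ⟶ M, f.hom.app Y k = M.obj.map k.op (repElt f) := fun f ↦ by
    have := ConcreteCategory.congr_hom (f.hom.naturality k.op) (𝟙 x : x ⟶ x)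
    refine Eq.trans ?_ this
    change f.hom.app Y k = f.hom.app Y (k ≫ 𝟙 x)
    rw [Category.comp_id]
  rw [key, key, h]

/-- The Yoneda lemma. -/
def repEquiv {x : X} {M : FMod.{w} X} : (rep.obj x ⟶ M) ≃ M.obj.obj (.op x) where
  toFun := repElt
  invFun := repLift
  left_inv _ := repElt_injective (repElt_repLift _)
  right_inv := repElt_repLift

lemma epi_app {M N : FMod.{w} X} (f : M ⟶ N) [Epi f] (x : Xᵒᵖ) : Epi (f.hom.app x) := by
  have := (additiveFunctor Xᵒᵖ AddCommGrpCat.{w}).preservesEpimorphisms_ι_of_isNormalMonoCategory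
  have : Epi ((additiveFunctor Xᵒᵖ AddCommGrpCat.{w}).ι.map f) := inferInstance
  exact inferInstanceAs (Epi (((additiveFunctor Xᵒᵖ AddCommGrpCat.{w}).ι.map f).app x))

instance projectiveRep (x : X) : Projective (rep.obj x) where
  factors f e _ := by
    have := epi_app e (.op x)
    obtain ⟨a, ha⟩ := (AddCommGrpCat.epi_iff_surjective _).1 this (repElt f)
    exact ⟨repLift a, repElt_injective (by rw [repElt_comp, repElt_repLift, ha])⟩

section EssentiallySmall

variable [EssentiallySmall.{w} X]

/-- A set of pairs `(x, a)` with `a ∈ M(x)`, where `x` runs over representatives of the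
isomorphism classes of `X`. -/
abbrev CoverIndex (M : FMod.{w} X) : Type w :=
  Σ x : SmallModel.{w} X, M.obj.obj (.op ((equivSmallModel X).inverse.obj x))

/-- The canonical epimorphism from a sum of representable functors to `M`. -/
def cover (M : FMod.{w} X) :
    (∐ fun j : CoverIndex M ↦ rep.obj ((equivSmallModel X).inverse.obj j.1)) ⟶ M :=
  Sigma.desc fun j ↦ repLift j.2

instance epi_cover (M : FMod.{w} X) : Epi (cover M) where
  left_cancellation {N} f g h := by
    have h' : ∀ (x : SmallModel.{w} X) (a : M.obj.obj (.op ((equivSmallModel X).inverse.obj x))),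
        f.hom.app _ a = g.hom.app _ a := fun x a ↦ by
      have := congrArg (fun k ↦ Sigma.ι (fun j : CoverIndex M ↦
        rep.obj ((equivSmallModel X).inverse.obj j.1)) ⟨x, a⟩ ≫ k) h
      simp only [cover, Sigma.ι_desc_assoc] at this
      have := congrArg repElt this
      simpa only [repElt_comp, repElt_repLift] using this
    ext Y a
    let e : (equivSmallModel X).inverse.obj ((equivSmallModel X).functor.obj Y.unop) ≅ Y.unop :=
      (equivSmallModel X).unitIso.symm.app Y.unop
    have h1 := h' _ (M.obj.map e.hom.op a)
    have nat : ∀ f : M ⟶ N, N.obj.map e.inv.op (f.hom.app _ (M.obj.map e.hom.op a)) =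
        f.hom.app Y a := fun f ↦ by
      have h2 := ConcreteCategory.congr_hom (f.hom.naturality e.inv.op) (M.obj.map e.hom.op a)
      refine h2.symm.trans ?_
      have h3 : M.obj.map e.hom.op ≫ M.obj.map e.inv.op = 𝟙 _ := by
        rw [← M.obj.map_comp, ← op_comp, e.inv_hom_id, op_id, M.obj.map_id]
      exact congrArg (f.hom.app Y) (ConcreteCategory.congr_hom h3 a)
    rw [← nat f, ← nat g, h1]

instance enoughProjectivesMod : EnoughProjectives (FMod.{w} X) where
  presentation M := ⟨{
    p := _
    projective := ⟨fun {E N} g e _ ↦ ⟨Sigma.desc fun j ↦ Projective.factorThru (Sigma.ι _ j ≫ g) e,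
      Sigma.hom_ext _ _ fun j ↦ by simp⟩⟩
    f := cover M }⟩

end EssentiallySmall

instance hasExtMod {C : Type w} [SmallCategory.{w} C] [Preadditive C] : HasExt.{w} (FMod.{w} C) :=
  hasExt_of_enoughProjectives _

/-- `X` has pseudokernels: every morphism `f : x₁ ⟶ x₀` admits a morphism `g : x₂ ⟶ x₁` such that
`X( , x₂) ⟶ X( , x₁) ⟶ X( , x₀)` is exact. -/
def HasPseudokernels (X : Type u) [Category.{w} X] [Preadditive X] : Prop :=
  ∀ ⦃x₁ x₀ : X⦄ (f : x₁ ⟶ x₀), ∃ (x₂ : X) (g : x₂ ⟶ x₁)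
    (h : rep.map g ≫ rep.map f = 0), (ShortComplex.mk (rep.map g) (rep.map f) h).Exact

/-- The class `mod(X)` of finitely presented functors: those `M` for which there is an exact
sequence `X( , x₁) ⟶ X( , x₀) ⟶ M ⟶ 0`. -/
def finPres (X : Type u) [Category.{w} X] [Preadditive X] : ObjectProperty (FMod.{w} X) := fun M ↦
  ∃ (x₁ x₀ : X) (f : rep.obj x₁ ⟶ rep.obj x₀) (p : rep.obj x₀ ⟶ M) (h : f ≫ p = 0),
    (ShortComplex.mk f p h).Exact ∧ Epi p

end ModuleCategory

section BrennerButler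

variable {C : Type w} [SmallCategory.{w} C] [Preadditive C] (T : ObjectProperty (FMod.{w} C))

/-- The full subcategory `T` of `Mod(C)` is a tilting subcategory: its objects are finitely
presented of projective dimension at most one, `Ext¹` vanishes between them, and every representable
functor has a coresolution `0 ⟶ C( , c) ⟶ T₁ ⟶ T₂ ⟶ 0` in `T`. -/
structure IsTilting : Prop where
  finPres : T ≤ finPres C
  projectiveDimension_le_one (M : FMod.{w} C) : T M → HasProjectiveDimensionLE M 1
  ext_one_eq_zero (M N : FMod.{w} C) : T M → T N → Subsingleton (Abelian.Ext M N 1)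
  coresolution (c : C) : ∃ (T₁ T₂ : FMod.{w} C) (i : rep.obj c ⟶ T₁) (p : T₁ ⟶ T₂) (h : i ≫ p = 0),
    T T₁ ∧ T T₂ ∧ (ShortComplex.mk i p h).ShortExact

/-- The functor `F = φ : Mod(C) ⥤ Mod(T)`, `F(M) = Hom( , M)` restricted to `T`. -/
def F : FMod.{w} C ⥤ FMod.{w} T.FullSubcategory :=
  (additiveFunctor _ _).lift
    (preadditiveYoneda ⋙ (Functor.whiskeringLeft _ _ _).obj T.ι.op) fun M ↦
      inferInstanceAs (Functor.Additive (T.ι.op ⋙ preadditiveYoneda.obj M))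

instance additive_extFunctor_flip (n : ℕ) (M : FMod.{w} C) :
    ((Abelian.extFunctor (C := FMod.{w} C) n).flip.obj M).Additive where
  map_add {A B f g} := by
    change ((Abelian.extFunctor n).map (f + g)).app M = _
    rw [Functor.map_add]
    rfl

/-- The functor `F' : Mod(C) ⥤ Mod(T)`, `F'(M) = Ext¹( , M)` restricted to `T`. -/
def F' : FMod.{w} C ⥤ FMod.{w} T.FullSubcategory :=
  (additiveFunctor _ _).lift
    ((Abelian.extFunctor 1).flip ⋙ (Functor.whiskeringLeft _ _ _).obj T.ι.op) fun M ↦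
      inferInstanceAs (Functor.Additive (T.ι.op ⋙ (Abelian.extFunctor 1).flip.obj M))

instance additive_F : (F T).Additive where
  map_add {M N f g} := by
    ext Y (k : Y.unop.obj ⟶ M)
    exact Preadditive.comp_add _ _ _ k f g

lemma leftAdjointObjIsDefined_rep (t : T.FullSubcategory) :
    (F T).leftAdjointObjIsDefined (rep.obj t) := by
  refine Functor.CorepresentableBy.isCorepresentable (X := t.obj)
    { homEquiv {M} := (repEquiv (M := (F T).obj M)).symm
      homEquiv_comp {M N} g f := ?_ }
  apply repElt_injective
  refine (repElt_repLift _).trans (Eq.symm ((repElt_comp _ _).trans ?_))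
  exact congrArg (((F T).map g).hom.app (.op t)) (repElt_repLift _)

lemma leftAdjointObjIsDefined_sigma {J : Type w} (t : J → T.FullSubcategory) :
    (F T).leftAdjointObjIsDefined (∐ fun j ↦ rep.obj (t j)) :=
  Functor.leftAdjointObjIsDefined_colimit _ fun j ↦ leftAdjointObjIsDefined_rep T (t j.as)

section

variable [EssentiallySmall.{w} T.FullSubcategory]

instance isRightAdjoint_F : (F T).IsRightAdjoint := by
  refine Functor.isRightAdjoint_of_leftAdjointObjIsDefined_eq_top ?_
  ext N
  simp only [Pi.top_apply, Prop.top_eq_true, iff_true]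
  let f := cover (kernel (cover N)) ≫ kernel.ι (cover N)
  have w : f ≫ cover N = 0 := by simp [f]
  have ex : (ShortComplex.mk f (cover N) w).Exact :=
    (ShortComplex.exact_iff_of_epi_of_isIso_of_mono
      (S₁ := ShortComplex.mk f (cover N) w)
      (S₂ := ShortComplex.mk (kernel.ι (cover N)) (cover N) (kernel.condition _))
      { τ₁ := cover _, τ₂ := 𝟙 _, τ₃ := 𝟙 _ }).2
        (ShortComplex.exact_of_f_is_kernel _ (kernelIsKernel _))
  have hc := ex.gIsCokernel
  refine Functor.leftAdjointObjIsDefined_of_isColimit hc ?_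
  rintro (_ | _)
  · exact leftAdjointObjIsDefined_sigma T _
  · exact leftAdjointObjIsDefined_sigma T _

/-- The functor `G = - ⊗ T : Mod(T) ⥤ Mod(C)`, defined as the left adjoint of `F`. -/
def G : FMod.{w} T.FullSubcategory ⥤ FMod.{w} C := (F T).leftAdjoint

/-- `G` is the left adjoint of `F`. -/
def adjunction : G T ⊣ F T := Adjunction.ofIsRightAdjoint (F T)

instance additive_G : (G T).Additive := (adjunction T).left_adjoint_additive

/-- The functor `G' = Tor₁( , T) : Mod(T) ⥤ Mod(C)`, the first left derived functor of `G`. -/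
def G' : FMod.{w} T.FullSubcategory ⥤ FMod.{w} C := (G T).leftDerived 1

end

/-- The torsion class of `T`: the epimorphic images of sums of objects of `T`. -/
def torsion : ObjectProperty (FMod.{w} C) := fun M ↦
  ∃ (ι : Type w) (t : ι → FMod.{w} C) (p : ∐ t ⟶ M), (∀ i, T (t i)) ∧ Epi p

/-- The torsion free class of `T`: the `N` with `Hom(M, N) = 0` for all `M` in the torsion class. -/
def torsionFree : ObjectProperty (FMod.{w} C) := fun N ↦
  ∀ ⦃M : FMod.{w} C⦄, torsion T M → ∀ f : M ⟶ N, f = 0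

/-- The class of the `N` with `N ⊗ T = 0`. -/
def classX [EssentiallySmall.{w} T.FullSubcategory] : ObjectProperty (FMod.{w} T.FullSubcategory) :=
  fun N ↦ IsZero ((G T).obj N)

/-- The class of the `N` with `Tor₁(N, T) = 0`. -/
def classY [EssentiallySmall.{w} T.FullSubcategory] : ObjectProperty (FMod.{w} T.FullSubcategory) :=
  fun N ↦ IsZero ((G' T).obj N)

end BrennerButler

/-- The functors `U : A ⥤ B` and `V : B ⥤ A` restrict to the full subcategories `P` of `A` and
`Q` of `B`, and the restrictions are mutually quasi-inverse equivalences. -/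
def InduceEquivalence {A B : Type*} [Category* A] [Category* B] (U : A ⥤ B) (V : B ⥤ A)
    (P : ObjectProperty A) (Q : ObjectProperty B) : Prop :=
  ∃ (hU : ∀ M, P M → Q (U.obj M)) (hV : ∀ N, Q N → P (V.obj N))
    (e : P.FullSubcategory ≌ Q.FullSubcategory),
    e.functor = Q.lift (P.ι ⋙ U) (fun M ↦ hU _ M.property) ∧
    e.inverse = P.lift (Q.ι ⋙ V) (fun N ↦ hV _ N.property)

end FunctorTilting

end

/-! Finite presentation plays no part in the equivalences themselves. They hold between the full
classes in `Mod(C)` and `Mod(T)`, and restrict as soon as the four functors preserve finite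
presentation.

Objects of `T` are finitely generated with finitely generated relations, so Hom and Ext¹ out of them
are controlled on direct sums: F and G exchange sums of representables T(-,t) with sums of the t,
and Ext¹ from `T` into such sums vanishes. The coresolutions then show that M is torsion iff F'(M) =
0 (`torsion_iff`). For torsion M the canonical map from a sum of objects of `T` is epi with torsion
kernel, and the counit is an isomorphism by comparison with that sum (`isIso_counit`).

For the unit, write N as P/K with P a sum of representables. The essential point is that the unit is
an isomorphism on subfunctors of P (`isIso_unit_of_mono`); it rests on `mono_G_kernel_cover`, which
amounts to Tor₁ vanishing on such subfunctors. If Tor₁(N,T) = 0, then G keeps 0 → K → P → N → 0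
exact, F keeps the result exact because F'G = 0, and the unit at N is an isomorphism (`isIso_unit`).

The second equivalence is a dimension shift. For torsion free M with injective hull sequence 0 → M →
I → I/M → 0, F gives 0 → F(I) → F(I/M) → F'(M) → 0, and G turns this into 0 → G'F'(M) → I → I/M. For
N with G(N) = 0, the sequence 0 → G'(N) → G(K) → G(P) → 0 yields in the same way K → P → F'G'(N) →
0.

Pseudokernels make finitely presented functors coherent, so they are closed under kernels, cokernels
and extensions. Long exact sequences then carry coherence from representables to all values of the
four functors. -/

noncomputable section
namespace FunctorTilting

/-! ### The first left derived functor and its connecting morphism. -/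

section Connecting

open HomologicalComplex

variable {A B : Type*} [Category* A] [Category* B] [Abelian A] [EnoughProjectives A] [Abelian B]
  (G : A ⥤ B) [G.Additive]

/-- The augmentation of a projective resolution. -/
def resolutionπ {X : A} (Q : ProjectiveResolution X) : Q.complex.X 0 ⟶ X := Q.π.f 0

omit [EnoughProjectives A] in
lemma d_comp_resolutionπ {X : A} (Q : ProjectiveResolution X) :
    Q.complex.d 1 0 ≫ resolutionπ Q = 0 := Q.complex_d_comp_π_f_zero

omit [EnoughProjectives A] in
lemma exact_resolutionπ {X : A} (Q : ProjectiveResolution X) :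
    (ShortComplex.mk _ _ (d_comp_resolutionπ Q)).Exact := Q.exact₀

instance epi_resolutionπ {X : A} (Q : ProjectiveResolution X) : Epi (resolutionπ Q) :=
  inferInstanceAs (Epi (Q.π.f 0))

section

variable {X : A} (Q : ProjectiveResolution X)

/-- The cokernel of `G(Q₂) ⟶ G(Q₁)`. -/
def opc : B := ((G.mapHomologicalComplex _).obj Q.complex).opcycles 1

/-- The projection of `G(Q₁)` to the cokernel of `G(Q₂) ⟶ G(Q₁)`. -/
def opcπ : G.obj (Q.complex.X 1) ⟶ opc G Q :=
  ((G.mapHomologicalComplex _).obj Q.complex).pOpcycles 1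

instance epi_opcπ : Epi (opcπ G Q) :=
  inferInstanceAs (Epi (((G.mapHomologicalComplex _).obj Q.complex).pOpcycles 1))

omit [EnoughProjectives A] in
lemma map_d_opcπ : G.map (Q.complex.d 2 1) ≫ opcπ G Q = 0 :=
  ((G.mapHomologicalComplex _).obj Q.complex).d_pOpcycles 2 1

/-- The cokernel property of `opcπ`. -/
def opcIsCokernel : IsColimit (CokernelCofork.ofπ (opcπ G Q) (map_d_opcπ G Q)) :=
  ((G.mapHomologicalComplex _).obj Q.complex).opcyclesIsCokernel 2 1 (by simp)

/-- The morphism from the cokernel of `G(Q₂) ⟶ G(Q₁)` to `G(Q₀)`. -/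
def opcd : opc G Q ⟶ G.obj (Q.complex.X 0) :=
  ((G.mapHomologicalComplex _).obj Q.complex).fromOpcycles 1 0

omit [EnoughProjectives A] in
lemma opcπ_opcd : opcπ G Q ≫ opcd G Q = G.map (Q.complex.d 1 0) :=
  ((G.mapHomologicalComplex _).obj Q.complex).p_fromOpcycles 1 0

/-- The first derived functor as a kernel. -/
def opcι : (G.leftDerived 1).obj X ⟶ opc G Q :=
  (Q.isoLeftDerivedObj G 1).hom ≫ ((G.mapHomologicalComplex _).obj Q.complex).homologyι 1

instance mono_opcι : Mono (opcι G Q) := by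
  have h : Mono ((((G.mapHomologicalComplex _).obj Q.complex).sc 1).homologyι) := inferInstance
  exact @mono_comp _ _ _ _ _ _ _ _ h

lemma opcι_opcd : opcι G Q ≫ opcd G Q = 0 := by
  refine (Category.assoc _ _ _).trans ?_
  have h := ((G.mapHomologicalComplex (ComplexShape.down ℕ)).obj
    Q.complex).homologyι_comp_fromOpcycles 1 0
  exact (congrArg ((Q.isoLeftDerivedObj G 1).hom ≫ ·) h).trans comp_zero

lemma exists_comp_opcι {W : B} (z : W ⟶ opc G Q) (hz : z ≫ opcd G Q = 0) :
    ∃ y, y ≫ opcι G Q = z := by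
  obtain ⟨y, hy⟩ := KernelFork.IsLimit.lift'
    (((G.mapHomologicalComplex _).obj Q.complex).homologyIsKernel 1 0 (by simp)) z hz
  exact ⟨y ≫ (Q.isoLeftDerivedObj G 1).inv, (Category.assoc _ _ _).trans
    ((congrArg (y ≫ ·) ((Q.isoLeftDerivedObj G 1).inv_hom_id_assoc _)).trans hy)⟩

variable {G Q} in
/-- The morphism from the cokernel of `G(Q₂) ⟶ G(Q₁)` induced by a morphism from `Q₁`. -/
def opcDesc {Y : A} (k : Q.complex.X 1 ⟶ Y) (hk : Q.complex.d 2 1 ≫ k = 0) :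
    opc G Q ⟶ G.obj Y :=
  (opcIsCokernel G Q).desc (CokernelCofork.ofπ (G.map k) (by rw [← G.map_comp, hk, G.map_zero]))

omit [EnoughProjectives A] in
lemma opcπ_opcDesc {Y : A} (k : Q.complex.X 1 ⟶ Y) (hk : Q.complex.d 2 1 ≫ k = 0) :
    opcπ G Q ≫ opcDesc k hk = G.map k :=
  (opcIsCokernel G Q).fac (CokernelCofork.ofπ (G.map k) (by rw [← G.map_comp, hk, G.map_zero]))
    WalkingParallelPair.one

lemma exists_opcMap {X' : A} {P : ProjectiveResolution X'} (f : X' ⟶ X)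
    (φ : P.complex ⟶ Q.complex) (comm : φ.f 0 ≫ resolutionπ Q = resolutionπ P ≫ f) :
    ∃ m : opc G P ⟶ opc G Q, opcπ G P ≫ m = G.map (φ.f 1) ≫ opcπ G Q ∧
      (G.leftDerived 1).map f ≫ opcι G Q = opcι G P ≫ m := by
  refine ⟨opcyclesMap ((G.mapHomologicalComplex _).map φ) 1,
    p_opcyclesMap ((G.mapHomologicalComplex (ComplexShape.down ℕ)).map φ) 1, ?_⟩
  have h1 := ProjectiveResolution.isoLeftDerivedObj_hom_naturality f P Q φ comm G 1
  have h2 := homologyι_naturality ((G.mapHomologicalComplex (ComplexShape.down ℕ)).map φ) 1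
  exact (Category.assoc _ _ _).symm.trans ((congrArg (· ≫ _) h1).trans
    ((Category.assoc _ _ _).trans ((congrArg (_ ≫ ·) h2).trans (Category.assoc _ _ _).symm)))

end

/-- The morphism `L₁G(X) ⟶ G(Y)` induced by a morphism `Q₁ ⟶ Y` that vanishes on `Q₂`, where `Q` is
a projective resolution of `X`. -/
def leftDerivedOneDesc {X Y : A} (Q : ProjectiveResolution X) (k : Q.complex.X 1 ⟶ Y)
    (hk : Q.complex.d 2 1 ≫ k = 0) : (G.leftDerived 1).obj X ⟶ G.obj Y :=
  opcι G Q ≫ opcDesc k hk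

/-- A homotopy changes the induced map by something that factors through `opcd`, which `opcι` kills.
Independence of the choices behind `leftδ` rests on this. -/
lemma leftDerivedOneDesc_eq {X Y : A} (Q : ProjectiveResolution X) (k k' : Q.complex.X 1 ⟶ Y)
    (hk : Q.complex.d 2 1 ≫ k = 0) (hk' : Q.complex.d 2 1 ≫ k' = 0)
    (h : Q.complex.X 0 ⟶ Y) (e : k = k' + Q.complex.d 1 0 ≫ h) :
    leftDerivedOneDesc G Q k hk = leftDerivedOneDesc G Q k' hk' := by
  have : opcDesc k hk = opcDesc k' hk' + opcd G Q ≫ G.map h := by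
    rw [← cancel_epi (opcπ G Q), Preadditive.comp_add, ← Category.assoc, opcπ_opcd, opcπ_opcDesc,
      opcπ_opcDesc, e, G.map_add, G.map_comp]
  rw [leftDerivedOneDesc, this, Preadditive.comp_add, ← Category.assoc, opcι_opcd, zero_comp,
    add_zero, leftDerivedOneDesc]

lemma leftDerivedOneDesc_comp {X Y Z : A} (Q : ProjectiveResolution X) (k : Q.complex.X 1 ⟶ Y)
    (hk : Q.complex.d 2 1 ≫ k = 0) (u : Y ⟶ Z) :
    leftDerivedOneDesc G Q k hk ≫ G.map u =
      leftDerivedOneDesc G Q (k ≫ u) (by rw [reassoc_of% hk, zero_comp]) := by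
  rw [leftDerivedOneDesc, leftDerivedOneDesc, Category.assoc]
  congr 1
  rw [← cancel_epi (opcπ G Q), reassoc_of% @opcπ_opcDesc, opcπ_opcDesc, G.map_comp]

lemma leftDerivedOneDesc_naturality {X X' Y : A} (P : ProjectiveResolution X)
    (Q : ProjectiveResolution X') (f : X ⟶ X') (φ : P.complex ⟶ Q.complex)
    (comm : φ.f 0 ≫ resolutionπ Q = resolutionπ P ≫ f) (k : Q.complex.X 1 ⟶ Y)
    (hk : Q.complex.d 2 1 ≫ k = 0) :
    (G.leftDerived 1).map f ≫ leftDerivedOneDesc G Q k hk =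
      leftDerivedOneDesc G P (φ.f 1 ≫ k) (by rw [← φ.comm_assoc, hk, comp_zero]) := by
  obtain ⟨m, hm, hm'⟩ := exists_opcMap G Q f φ comm
  rw [leftDerivedOneDesc, leftDerivedOneDesc, reassoc_of% hm']
  congr 1
  rw [← cancel_epi (opcπ G P), reassoc_of% hm, opcπ_opcDesc, opcπ_opcDesc, G.map_comp]

/-- Here `k` and `i` form the image factorisation of the differential. Right exactness identifies
`G.obj Y` with `opc G Q`, and the derived functor is the kernel of `opcd`. -/
lemma mono_leftDerivedOneDesc [PreservesFiniteColimits G] {X Y : A} (Q : ProjectiveResolution X)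
    (k : Q.complex.X 1 ⟶ Y) (i : Y ⟶ Q.complex.X 0) [Epi k] [Mono i]
    (hi : k ≫ i = Q.complex.d 1 0) (hk : Q.complex.d 2 1 ≫ k = 0) :
    Mono (leftDerivedOneDesc G Q k hk) ∧ ∀ {W : B} (x : W ⟶ G.obj Y), x ≫ G.map i = 0 →
      ∃ y, y ≫ leftDerivedOneDesc G Q k hk = x := by
  have ex : (ShortComplex.mk _ _ hk).Exact := by
    refine (ShortComplex.exact_iff_of_epi_of_isIso_of_mono
      (S₁ := ShortComplex.mk _ _ hk) (S₂ := ShortComplex.mk _ _ (Q.complex.d_comp_d 2 1 0))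
      { τ₁ := 𝟙 _, τ₂ := 𝟙 _, τ₃ := i }).2 (Q.exact_succ 0)
  have hGk : G.map (Q.complex.d 2 1) ≫ G.map k = 0 := by rw [← G.map_comp, hk, G.map_zero]
  have hc : IsColimit (CokernelCofork.ofπ (G.map k) hGk) :=
    isColimitCoforkMapOfIsColimit' G hk ex.gIsCokernel
  have iso : IsIso (opcDesc (G := G) k hk) := by
    have : opcDesc (G := G) k hk =
        (IsColimit.coconePointUniqueUpToIso (opcIsCokernel G Q) hc).hom := by
      rw [← cancel_epi (opcπ G Q), opcπ_opcDesc]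
      exact (IsColimit.comp_coconePointUniqueUpToIso_hom
        (opcIsCokernel G Q) hc WalkingParallelPair.one).symm
    rw [this]; infer_instance
  have hi' : opcDesc k hk ≫ G.map i = opcd G Q := by
    rw [← cancel_epi (opcπ G Q), reassoc_of% @opcπ_opcDesc, opcπ_opcd, ← hi, G.map_comp]
  constructor
  · unfold leftDerivedOneDesc
    infer_instance
  · intro W x hx
    obtain ⟨y, hy⟩ := exists_comp_opcι G Q (x ≫ inv (opcDesc k hk)) (by
      rw [← hi', Category.assoc, IsIso.inv_hom_id_assoc, hx])
    exact ⟨y, by rw [leftDerivedOneDesc, reassoc_of% hy]; simp⟩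

section

variable {S : ShortComplex A} (hS : S.ShortExact)

omit [EnoughProjectives A] in
include hS in
lemma exists_resolution_lift (Q : ProjectiveResolution S.X₃) :
    ∃ (q₀ : Q.complex.X 0 ⟶ S.X₂) (q₁ : Q.complex.X 1 ⟶ S.X₁),
      q₀ ≫ S.g = resolutionπ Q ∧ q₁ ≫ S.f = Q.complex.d 1 0 ≫ q₀ := by
  have := hS.mono_f
  have := hS.epi_g
  let q₀ : Q.complex.X 0 ⟶ S.X₂ := Projective.factorThru (resolutionπ Q) S.g
  have h₀ : q₀ ≫ S.g = resolutionπ Q := Projective.factorThru_comp _ _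
  exact ⟨q₀, hS.exact.lift (Q.complex.d 1 0 ≫ q₀)
    (by rw [Category.assoc, h₀, d_comp_resolutionπ]), h₀,
    hS.exact.lift_f _ _⟩

omit [EnoughProjectives A] in
include hS in
lemma d_comp_resolution_lift {Q : ProjectiveResolution S.X₃} {q₀ : Q.complex.X 0 ⟶ S.X₂}
    {q₁ : Q.complex.X 1 ⟶ S.X₁} (h₁ : q₁ ≫ S.f = Q.complex.d 1 0 ≫ q₀) :
    Q.complex.d 2 1 ≫ q₁ = 0 := by
  have := hS.mono_f
  rw [← cancel_mono S.f, Category.assoc, h₁]; simp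

/-- The connecting morphism `L₁G(X₃) ⟶ G(X₁)` of a short exact sequence. -/
def leftδ : (G.leftDerived 1).obj S.X₃ ⟶ G.obj S.X₁ :=
  leftDerivedOneDesc G (ProjectiveResolution.of S.X₃)
    (exists_resolution_lift hS (.of S.X₃)).choose_spec.choose
    (d_comp_resolution_lift hS
      (exists_resolution_lift hS (.of S.X₃)).choose_spec.choose_spec.2)

lemma leftDerivedOneDesc_eq_of_lift {P Q : ProjectiveResolution S.X₃}
    {p₀ : P.complex.X 0 ⟶ S.X₂} {p₁ : P.complex.X 1 ⟶ S.X₁}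
    {q₀ : Q.complex.X 0 ⟶ S.X₂} {q₁ : Q.complex.X 1 ⟶ S.X₁}
    (hp₀ : p₀ ≫ S.g = resolutionπ P) (hp₁ : p₁ ≫ S.f = P.complex.d 1 0 ≫ p₀)
    (hq₀ : q₀ ≫ S.g = resolutionπ Q) (hq₁ : q₁ ≫ S.f = Q.complex.d 1 0 ≫ q₀) :
    leftDerivedOneDesc G P p₁ (d_comp_resolution_lift hS hp₁) =
      leftDerivedOneDesc G Q q₁ (d_comp_resolution_lift hS hq₁) := by
  have := hS.mono_f
  let φ := ProjectiveResolution.lift (𝟙 S.X₃) P Q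
  have comm : φ.f 0 ≫ resolutionπ Q = resolutionπ P ≫ 𝟙 _ :=
    ProjectiveResolution.lift_commutes_zero _ _ _
  have h := leftDerivedOneDesc_naturality G P Q (𝟙 _) φ comm q₁ (d_comp_resolution_lift hS hq₁)
  rw [CategoryTheory.Functor.map_id, Category.id_comp] at h
  rw [h]
  refine leftDerivedOneDesc_eq G P _ _ _ _ (hS.exact.lift (p₀ - φ.f 0 ≫ q₀) ?_) ?_
  · rw [Preadditive.sub_comp, hp₀, Category.assoc, hq₀, comm]; simp
  · rw [← cancel_mono S.f, Preadditive.add_comp, Category.assoc, Category.assoc, hp₁, hq₁,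
      hS.exact.lift_f, φ.comm_assoc]
    simp

lemma leftδ_eq {Q : ProjectiveResolution S.X₃}
    {q₀ : Q.complex.X 0 ⟶ S.X₂} {q₁ : Q.complex.X 1 ⟶ S.X₁}
    (hq₀ : q₀ ≫ S.g = resolutionπ Q) (hq₁ : q₁ ≫ S.f = Q.complex.d 1 0 ≫ q₀) :
    leftδ G hS = leftDerivedOneDesc G Q q₁ (d_comp_resolution_lift hS hq₁) :=
  leftDerivedOneDesc_eq_of_lift G hS
    (exists_resolution_lift hS (.of S.X₃)).choose_spec.choose_spec.1
    (exists_resolution_lift hS (.of S.X₃)).choose_spec.choose_spec.2 hq₀ hq₁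

/-- Both sides come from lifts of the same map to `S'.X₃`; the difference of the degree zero lifts
lands in `S'.X₁` and is the required homotopy. -/
lemma leftδ_naturality {S' : ShortComplex A} (hS' : S'.ShortExact) (φ : S ⟶ S') :
    (G.leftDerived 1).map φ.τ₃ ≫ leftδ G hS' = leftδ G hS ≫ G.map φ.τ₁ := by
  let P := ProjectiveResolution.of S.X₃
  let Q := ProjectiveResolution.of S'.X₃
  obtain ⟨p₀, p₁, hp₀, hp₁⟩ := exists_resolution_lift hS P
  obtain ⟨q₀, q₁, hq₀, hq₁⟩ := exists_resolution_lift hS' Q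
  let ψ := ProjectiveResolution.lift φ.τ₃ P Q
  have comm : ψ.f 0 ≫ resolutionπ Q = resolutionπ P ≫ φ.τ₃ :=
    ProjectiveResolution.lift_commutes_zero _ _ _
  have := hS'.mono_f
  rw [leftδ_eq G hS hp₀ hp₁, leftδ_eq G hS' hq₀ hq₁, leftDerivedOneDesc_comp,
    leftDerivedOneDesc_naturality G P Q _ ψ comm]
  refine leftDerivedOneDesc_eq G P _ _ _ _ (hS'.exact.lift (ψ.f 0 ≫ q₀ - p₀ ≫ φ.τ₂) ?_) ?_
  · rw [Preadditive.sub_comp, Category.assoc, Category.assoc, hq₀, comm, φ.comm₂₃, reassoc_of% hp₀]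
    simp
  · rw [← cancel_mono S'.f, Preadditive.add_comp]
    simp only [Category.assoc, hS'.exact.lift_f, φ.comm₁₂, reassoc_of% hp₁, hq₁,
      Preadditive.comp_sub, ψ.comm_assoc]
    abel

lemma leftδ_comp : leftδ G hS ≫ G.map S.f = 0 := by
  obtain ⟨q₀, q₁, hq₀, hq₁⟩ := exists_resolution_lift hS (ProjectiveResolution.of S.X₃)
  rw [leftδ_eq G hS hq₀ hq₁, leftDerivedOneDesc_comp,
    leftDerivedOneDesc_eq G _ _ 0 _ (by simp) q₀ (by simp [hq₁])]
  have := leftDerivedOneDesc_comp G (ProjectiveResolution.of S.X₃) (0 : _ ⟶ S.X₂) (by simp)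
    (0 : _ ⟶ S.X₂)
  simpa using this.symm

end

omit [EnoughProjectives A] in
lemma exact_map_of_epi [PreservesFiniteColimits G] {X Y Z : A} {f : X ⟶ Y} {g : Y ⟶ Z}
    {w : f ≫ g = 0}
    (h : (ShortComplex.mk f g w).Exact) [Epi g] :
    (ShortComplex.mk (G.map f) (G.map g) (by rw [← G.map_comp, w, G.map_zero])).Exact :=
  ShortComplex.exact_of_g_is_cokernel _ (isColimitCoforkMapOfIsColimit' G w
    (have : Epi (ShortComplex.mk f g w).g := ‹Epi g›; h.gIsCokernel))

omit [EnoughProjectives A] in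
lemma shortExact_kernel {X Y : A} (p : X ⟶ Y) [Epi p] :
    (ShortComplex.mk (kernel.ι p) p (kernel.condition p)).ShortExact :=
  { exact := ShortComplex.exact_of_f_is_kernel _ (kernelIsKernel _) }

omit [EnoughProjectives A] in
lemma shortExact_cokernel {X Y : A} (i : X ⟶ Y) [Mono i] :
    (ShortComplex.mk i (cokernel.π i) (cokernel.condition i)).ShortExact :=
  { exact := ShortComplex.exact_of_g_is_cokernel _ (cokernelIsCokernel _) }

/-- A morphism of short exact sequences determined by its last two components. -/
def homOfτ₂τ₃ {S S' : ShortComplex A} (hS' : S'.ShortExact) (a : S.X₂ ⟶ S'.X₂) (b : S.X₃ ⟶ S'.X₃)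
    (h : a ≫ S'.g = S.g ≫ b) : S ⟶ S' :=
  have := hS'.mono_f
  { τ₁ := hS'.exact.lift (S.f ≫ a) (by rw [Category.assoc, h, S.zero_assoc, zero_comp])
    τ₂ := a
    τ₃ := b
    comm₁₂ := hS'.exact.lift_f _ _
    comm₂₃ := h }

omit [EnoughProjectives A] in
lemma exists_hom_of_projective {S S' : ShortComplex A} (hS' : S'.ShortExact) [Projective S.X₂]
    (f : S.X₃ ⟶ S'.X₃) : ∃ φ : S ⟶ S', φ.τ₃ = f :=
  have := hS'.epi_g
  ⟨homOfτ₂τ₃ hS' (Projective.factorThru (S.g ≫ f) S'.g) f (Projective.factorThru_comp _ _), rfl⟩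

omit [EnoughProjectives A] in
lemma exists_hom_of_injective {S S' : ShortComplex A} (hS : S.ShortExact) [Injective S'.X₂]
    (f : S.X₁ ⟶ S'.X₁) : ∃ φ : S ⟶ S', φ.τ₁ = f := by
  have := hS.mono_f
  have := hS.epi_g
  let a := Injective.factorThru (f ≫ S'.f) S.f
  have ha : S.f ≫ a = f ≫ S'.f := Injective.comp_factorThru _ _
  exact ⟨{
    τ₁ := f
    τ₂ := a
    τ₃ := hS.exact.desc (a ≫ S'.g) (by rw [reassoc_of% ha, S'.zero, comp_zero])
    comm₁₂ := ha.symm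
    comm₂₃ := (hS.exact.g_desc _ _).symm }, rfl⟩

omit [EnoughProjectives A] in
lemma exists_homotopy {S S' : ShortComplex A} (hS' : S'.ShortExact) (φ ψ : S ⟶ S')
    (h : φ.τ₃ = ψ.τ₃) : ∃ k : S.X₂ ⟶ S'.X₁, φ.τ₁ = ψ.τ₁ + S.f ≫ k := by
  have := hS'.mono_f
  refine ⟨hS'.exact.lift (φ.τ₂ - ψ.τ₂) ?_, ?_⟩
  · rw [Preadditive.sub_comp, φ.comm₂₃, ψ.comm₂₃, h, sub_self]
  · rw [← cancel_mono S'.f, Preadditive.add_comp, Category.assoc, hS'.exact.lift_f,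
      Preadditive.comp_sub, φ.comm₁₂, ψ.comm₁₂]
    abel

section

variable [PreservesFiniteColimits G]

/-- The connecting morphism is a kernel of `G(X₁) ⟶ G(X₂)`. -/
def LeftδIsKernel {S : ShortComplex A} (hS : S.ShortExact) : Prop :=
  Mono (leftδ G hS) ∧ ∀ {W : B} (x : W ⟶ G.obj S.X₁), x ≫ G.map S.f = 0 →
    ∃ y, y ≫ leftδ G hS = x

lemma leftδIsKernel_resolution {X : A} (Q : ProjectiveResolution X) :
    LeftδIsKernel G (shortExact_kernel (resolutionπ Q)) := by
  let k : Q.complex.X 1 ⟶ kernel (resolutionπ Q) := kernel.lift _ _ (d_comp_resolutionπ Q)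
  have hk : k ≫ kernel.ι _ = Q.complex.d 1 0 := kernel.lift_ι _ _ _
  have : Epi k := (exact_resolutionπ Q).epi_kernelLift
  have h0 : Q.complex.d 2 1 ≫ k = 0 := by rw [← cancel_mono (kernel.ι _), Category.assoc, hk]; simp
  have := mono_leftDerivedOneDesc G Q k (kernel.ι (resolutionπ Q)) hk h0
  rw [← leftδ_eq G (shortExact_kernel (resolutionπ Q)) (Q := Q) (q₀ := 𝟙 _) (q₁ := k) (by simp)
    (by simpa using hk)] at this
  exact this

/-- The sequence is compared with that of a projective resolution. Both middle terms are projective,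
so the identity of `S.X₃` lifts both ways, and the round trip on `S.X₁` is the identity up to a map
through `S.f`, invisible on the kernel of `G.map S.f`. -/
lemma leftδIsKernel_of_projective {S : ShortComplex A} (hS : S.ShortExact) [Projective S.X₂] :
    LeftδIsKernel G hS := by
  let Q := ProjectiveResolution.of S.X₃
  have hQ := shortExact_kernel (resolutionπ Q)
  obtain ⟨h1, h2⟩ := leftδIsKernel_resolution G Q
  have : Projective (ShortComplex.mk _ _ (kernel.condition (resolutionπ Q))).X₂ := Q.projective 0
  obtain ⟨φ, hφ⟩ := exists_hom_of_projective hS (S := ShortComplex.mk _ _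
    (kernel.condition (resolutionπ Q))) (𝟙 S.X₃)
  obtain ⟨ψ, hψ⟩ := exists_hom_of_projective hQ (S := S) (𝟙 S.X₃)
  have nφ := leftδ_naturality G hQ hS φ
  have nψ := leftδ_naturality G hS hQ ψ
  rw [hφ] at nφ
  rw [hψ] at nψ
  replace nφ := (Category.id_comp _).symm.trans ((congrArg (· ≫ leftδ G hS)
    ((G.leftDerived 1).map_id S.X₃).symm).trans nφ)
  replace nψ := (Category.id_comp _).symm.trans ((congrArg (· ≫ leftδ G hQ)
    ((G.leftDerived 1).map_id S.X₃).symm).trans nψ)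
  constructor
  · have : Mono (leftδ G hS ≫ G.map ψ.τ₁) := by rw [← nψ]; exact h1
    exact mono_of_mono _ (G.map ψ.τ₁)
  · intro W x hx
    obtain ⟨y, hy⟩ := h2 (x ≫ G.map ψ.τ₁) (by
      rw [Category.assoc, ← G.map_comp]
      refine (congrArg (x ≫ G.map ·) ψ.comm₁₂).trans ?_
      rw [G.map_comp, reassoc_of% hx, zero_comp])
    refine ⟨y, ?_⟩
    obtain ⟨k, hk⟩ := exists_homotopy hS (ψ ≫ φ) (𝟙 S) (by
      rw [ShortComplex.comp_τ₃, hφ, hψ]; exact Category.comp_id _)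
    rw [nφ, ← Category.assoc, hy, Category.assoc, ← G.map_comp]
    rw [ShortComplex.comp_τ₁] at hk
    rw [hk, G.map_add, Preadditive.comp_add, G.map_comp, reassoc_of% hx, zero_comp, add_zero]
    exact (congrArg (x ≫ ·) (G.map_id _)).trans (Category.comp_id _)

/-- Cover `S.X₂` by a projective P, with K₂ and K₃ the kernels of P → X₂ and P → X₃; then 0 → K₂ →
K₃ → X₁ → 0 is exact. The projective case computes L₁G(X₃) as the kernel of G(K₃) → G(P), and
L₁G(X₂) = 0 makes G(K₂) → G(P) mono. A chase finishes. -/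
lemma leftδIsKernel {S : ShortComplex A} (hS : S.ShortExact)
    (h0 : IsZero ((G.leftDerived 1).obj S.X₂)) : LeftδIsKernel G hS := by
  have := hS.mono_f
  have := hS.epi_g
  let π := Projective.π S.X₂
  have h₂ := shortExact_kernel π
  have h₃ := shortExact_kernel (π ≫ S.g)
  have : Projective (ShortComplex.mk _ _ (kernel.condition π)).X₂ := Projective.projective_over _
  have : Projective (ShortComplex.mk _ _ (kernel.condition (π ≫ S.g))).X₂ :=
    Projective.projective_over _
  have k₂ := leftδIsKernel_of_projective G h₂
  have k₃ := leftδIsKernel_of_projective G h₃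
  let φ : ShortComplex.mk _ _ (kernel.condition (π ≫ S.g)) ⟶ S := homOfτ₂τ₃ hS π (𝟙 _) (by simp)
  let b : kernel (π ≫ S.g) ⟶ S.X₁ := φ.τ₁
  have hb : b ≫ S.f = kernel.ι (π ≫ S.g) ≫ π := φ.comm₁₂
  let a : kernel π ⟶ kernel (π ≫ S.g) := kernel.lift _ (kernel.ι π) (by simp)
  have ha : a ≫ kernel.ι _ = kernel.ι π := kernel.lift_ι _ _ _
  let d : (G.leftDerived 1).obj S.X₃ ⟶ G.obj (kernel (π ≫ S.g)) := leftδ G h₃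
  have md : Mono d := k₃.1
  have kd : ∀ {W : B} (x : W ⟶ G.obj (kernel (π ≫ S.g))), x ≫ G.map (kernel.ι (π ≫ S.g)) = 0 →
    ∃ y, y ≫ d = x := k₃.2
  have d0 : d ≫ G.map (kernel.ι (π ≫ S.g)) = 0 := leftδ_comp G h₃
  have n : leftδ G hS = d ≫ G.map b :=
    (Category.id_comp _).symm.trans ((congrArg (· ≫ leftδ G hS)
      ((G.leftDerived 1).map_id S.X₃).symm).trans (leftδ_naturality G h₃ hS φ))
  have hab : a ≫ b = 0 := by rw [← cancel_mono S.f, Category.assoc, hb, reassoc_of% ha]; simp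
  have eb : Epi b := by
    rw [epi_iff_surjective_up_to_refinements]
    intro W x
    obtain ⟨W', p, hp, y, hy⟩ := surjective_up_to_refinements_of_epi π (x ≫ S.f)
    refine ⟨W', p, hp, kernel.lift _ y (by rw [← reassoc_of% hy]; simp), ?_⟩
    rw [← cancel_mono S.f, Category.assoc, Category.assoc, hb, kernel.lift_ι_assoc, hy]
  have ex : (ShortComplex.mk a b hab).Exact := by
    rw [ShortComplex.exact_iff_exact_up_to_refinements]
    intro W (z : W ⟶ kernel (π ≫ S.g)) (hz : z ≫ b = 0)
    refine ⟨W, 𝟙 _, inferInstance, kernel.lift π (z ≫ kernel.ι _) ?_, ?_⟩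
    · rw [Category.assoc, ← hb, reassoc_of% hz, zero_comp]
    · change 𝟙 _ ≫ z = kernel.lift π _ _ ≫ a
      rw [← cancel_mono (kernel.ι _), Category.assoc _ a, ha]
      simp
  have exG := exact_map_of_epi G ex
  have key : ∀ {W : B} (z : W ⟶ G.obj (kernel π)), z ≫ G.map (kernel.ι π) = 0 → z = 0 := by
    intro W z hz
    obtain ⟨y, rfl⟩ := k₂.2 z hz
    rw [h0.eq_zero_of_tgt y, zero_comp]
  have exπ := exact_map_of_epi G h₂.exact
  have mono : Mono (leftδ G hS) := by
    refine Preadditive.mono_of_cancel_zero _ fun {W} y hy ↦ ?_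
    rw [n, ← Category.assoc] at hy
    obtain ⟨W', p, hp, z, hz⟩ := exG.exact_up_to_refinements (y ≫ d) hy
    change p ≫ y ≫ d = z ≫ G.map a at hz
    have : z = 0 := key z (by
      rw [← ha, G.map_comp, ← reassoc_of% hz, d0, comp_zero, comp_zero])
    rw [this, zero_comp] at hz
    rw [← cancel_mono d, ← cancel_epi p, hz, zero_comp, comp_zero]
  · refine ⟨mono, fun {W} x hx ↦ ?_⟩
    obtain ⟨W₁, p₁, _, z, hz⟩ := surjective_up_to_refinements_of_epi (G.map b) x
    obtain ⟨W₂, p₂, _, w, hw⟩ := exπ.exact_up_to_refinements (z ≫ G.map (kernel.ι (π ≫ S.g))) (by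
      change (z ≫ G.map (kernel.ι (π ≫ S.g))) ≫ G.map π = 0
      rw [Category.assoc, ← G.map_comp, ← hb, G.map_comp, ← reassoc_of% hz, hx, comp_zero])
    replace hw : p₂ ≫ z ≫ G.map (kernel.ι (π ≫ S.g)) = w ≫ G.map (kernel.ι π) := hw
    have ha' : G.map a ≫ G.map (kernel.ι (π ≫ S.g)) = G.map (kernel.ι π) := by
      rw [← G.map_comp, ha]
    obtain ⟨y, hy⟩ := kd (p₂ ≫ z - w ≫ G.map a) (by
      rw [Preadditive.sub_comp, Category.assoc, Category.assoc, ha', hw, sub_self])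
    have hy' : y ≫ leftδ G hS = (p₂ ≫ p₁) ≫ x := by
      rw [n, reassoc_of% hy, Preadditive.sub_comp, Category.assoc, Category.assoc, ← hz,
        ← G.map_comp, hab, G.map_zero, comp_zero, sub_zero, Category.assoc]
    -- The factorisation exists so far only after the epimorphism `p₂ ≫ p₁`; it descends because
    -- `leftδ` is mono.
    refine ⟨Abelian.monoLift (leftδ G hS) x ?_, Abelian.monoLift_comp _ _ _⟩
    rw [← cancel_epi (p₂ ≫ p₁), ← Category.assoc, ← hy', Category.assoc, cokernel.condition,
      comp_zero, comp_zero]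

end

end Connecting

/-! ### Representable functors as projective generators. -/

section Representables

variable {X : Type u} [Category.{w} X] [Preadditive X]

instance additive_rep : (rep : X ⥤ FMod.{w} X).Additive where
  map_add {x y f g} := by
    ext Y (k : Y.unop ⟶ x)
    exact Preadditive.comp_add _ _ _ k f g

lemma rep_map_repElt {x y : X} (f : rep.obj x ⟶ rep.obj y) :
    rep.map (repElt f : x ⟶ y) = f := by
  apply repElt_injective
  change 𝟙 x ≫ repElt f = repElt f
  exact Category.id_comp _

lemma exists_lift_of_epi {M N : FMod.{w} X} (f : M ⟶ N) [Epi f] {x : X} (b : rep.obj x ⟶ N) :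
    ∃ a, a ≫ f = b := ⟨Projective.factorThru b f, Projective.factorThru_comp _ _⟩

lemma exists_lift_of_exact {S : ShortComplex (FMod.{w} X)} (hS : S.Exact) {x : X}
    (b : rep.obj x ⟶ S.X₂) (hb : b ≫ S.g = 0) : ∃ a, a ≫ S.f = b :=
  ⟨hS.liftFromProjective b hb, hS.liftFromProjective_comp _ _⟩

section

variable [EssentiallySmall.{w} X]

/-- Representables generate, by `cover`. This and the next three criteria reduce exactness in
`Mod(X)` to maps from representables. -/
lemma hom_ext_rep {M N : FMod.{w} X} {f g : M ⟶ N}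
    (h : ∀ (x : X) (b : rep.obj x ⟶ M), b ≫ f = b ≫ g) : f = g := by
  rw [← cancel_epi (cover M)]
  exact Sigma.hom_ext _ _ fun j ↦ by rw [← Category.assoc, ← Category.assoc, h]

lemma epi_of_rep {M N : FMod.{w} X} (f : M ⟶ N)
    (h : ∀ (x : X) (b : rep.obj x ⟶ N), ∃ a, a ≫ f = b) : Epi f := by
  choose l hl using h
  refine epi_of_epi_fac (f := Sigma.desc fun j : CoverIndex N ↦
    l _ (Sigma.ι (fun j : CoverIndex N ↦ rep.obj ((equivSmallModel X).inverse.obj j.1)) j ≫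
      cover N))
    (h := cover N) (Sigma.hom_ext _ _ fun j ↦ ?_)
  rw [Sigma.ι_desc_assoc, hl]

lemma mono_of_rep {M N : FMod.{w} X} (f : M ⟶ N)
    (h : ∀ (x : X) (b : rep.obj x ⟶ M), b ≫ f = 0 → b = 0) : Mono f := by
  refine Preadditive.mono_of_cancel_zero _ fun {W} g hg ↦ hom_ext_rep fun x b ↦ ?_
  rw [comp_zero, h x (b ≫ g) (by rw [Category.assoc, hg, comp_zero])]

lemma exact_of_rep {S : ShortComplex (FMod.{w} X)}
    (h : ∀ (x : X) (b : rep.obj x ⟶ S.X₂), b ≫ S.g = 0 → ∃ a, a ≫ S.f = b) : S.Exact := by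
  rw [S.exact_iff_epi_kernel_lift]
  refine epi_of_rep _ fun x b ↦ ?_
  obtain ⟨a, ha⟩ := h x (b ≫ kernel.ι _) (by simp)
  exact ⟨a, by rw [← cancel_mono (kernel.ι _), Category.assoc, kernel.lift_ι, ha]⟩

end

/-! ### Coherent functors. -/

section Coherent

/-- `M` is finitely generated. -/
def IsFG (M : FMod.{w} X) : Prop := ∃ (x : X) (p : rep.obj x ⟶ M), Epi p

/-- `M` is coherent: it is finitely generated, and so is the kernel of every morphism from a
representable functor to `M`. -/
def IsCoh (M : FMod.{w} X) : Prop :=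
  IsFG M ∧ ∀ ⦃x : X⦄ (f : rep.obj x ⟶ M), ∃ (z : X) (k : rep.obj z ⟶ rep.obj x), k ≫ f = 0 ∧
    ∀ ⦃y : X⦄ (b : rep.obj y ⟶ rep.obj x), b ≫ f = 0 → ∃ c, c ≫ k = b

lemma IsFG.of_epi {M N : FMod.{w} X} (h : IsFG M) (f : M ⟶ N) [Epi f] : IsFG N := by
  obtain ⟨x, p, _⟩ := h
  exact ⟨x, p ≫ f, epi_comp _ _⟩

lemma isFG_rep (x : X) : IsFG (rep.obj x) := ⟨x, 𝟙 _, inferInstance⟩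

lemma IsCoh.finPres [EssentiallySmall.{w} X] {M : FMod.{w} X} (h : IsCoh M) : finPres X M := by
  obtain ⟨⟨x, p, hp⟩, h⟩ := h
  obtain ⟨z, k, hk, hk'⟩ := h p
  exact ⟨z, x, k, p, hk, exact_of_rep fun y b hb ↦ hk' b hb, hp⟩

lemma IsCoh.of_mono {M N : FMod.{w} X} (h : IsCoh N) (hM : IsFG M) (i : M ⟶ N) [Mono i] :
    IsCoh M := by
  refine ⟨hM, fun x f ↦ ?_⟩
  obtain ⟨z, k, hk, hk'⟩ := h.2 (f ≫ i)
  exact ⟨z, k, by rw [← cancel_mono i, Category.assoc, hk, zero_comp], fun y b hb ↦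
    hk' b (by rw [reassoc_of% hb, zero_comp])⟩

variable [EssentiallySmall.{w} X]

/-- Only finite generation is at stake: a generator of the kernel of X(-,x) → X₂ → X₃ maps onto X₁.
-/
lemma IsCoh.kernel {S : ShortComplex (FMod.{w} X)} (hS : S.Exact) [Mono S.f] (h₂ : IsCoh S.X₂)
    (h₃ : IsCoh S.X₃) : IsCoh S.X₁ := by
  refine h₂.of_mono ?_ S.f
  obtain ⟨x, p, hp⟩ := h₂.1
  obtain ⟨z, k, hk, hk'⟩ := h₃.2 (p ≫ S.g)
  obtain ⟨a, ha⟩ := exists_lift_of_exact hS (k ≫ p) (by rw [Category.assoc, hk])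
  refine ⟨z, a, epi_of_rep _ fun y b ↦ ?_⟩
  obtain ⟨c, hc⟩ := exists_lift_of_epi p (b ≫ S.f)
  obtain ⟨e, rfl⟩ := hk' c (by rw [reassoc_of% hc, S.zero, comp_zero])
  exact ⟨e, by rw [← cancel_mono S.f, Category.assoc, ha, ← hc, Category.assoc]⟩

variable [HasBinaryBiproducts X]

/-- The morphism from the functor represented by a biproduct. -/
def repDesc {x y : X} {M : FMod.{w} X} (a : rep.obj x ⟶ M) (b : rep.obj y ⟶ M) :
    rep.obj (x ⊞ y) ⟶ M := rep.map biprod.fst ≫ a + rep.map biprod.snd ≫ b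

omit [EssentiallySmall.{w} X] in
lemma inl_repDesc {x y : X} {M : FMod.{w} X} (a : rep.obj x ⟶ M) (b : rep.obj y ⟶ M) :
    rep.map biprod.inl ≫ repDesc a b = a := by
  simp [repDesc, ← Functor.map_comp_assoc]

omit [EssentiallySmall.{w} X] in
lemma inr_repDesc {x y : X} {M : FMod.{w} X} (a : rep.obj x ⟶ M) (b : rep.obj y ⟶ M) :
    rep.map biprod.inr ≫ repDesc a b = b := by
  simp [repDesc, ← Functor.map_comp_assoc]

omit [EssentiallySmall.{w} X] in
lemma isFG_of_exact {S : ShortComplex (FMod.{w} X)} (hS : S.Exact) [Epi S.g] (h₁ : IsFG S.X₁)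
    (h₃ : IsFG S.X₃) : IsFG S.X₂ := by
  obtain ⟨x, p, hp⟩ := h₁
  obtain ⟨y, q, hq⟩ := h₃
  obtain ⟨r, hr⟩ := exists_lift_of_epi S.g q
  refine ⟨_, repDesc (p ≫ S.f) r, Preadditive.epi_of_cancel_zero _ fun {W} g hg ↦ ?_⟩
  have h1 : p ≫ S.f ≫ g = 0 := by
    simpa using ((reassoc_of% inl_repDesc (p ≫ S.f) r) g).symm.trans (by rw [hg, comp_zero])
  have h2 : r ≫ g = 0 :=
    ((reassoc_of% inr_repDesc (p ≫ S.f) r) g).symm.trans (by rw [hg, comp_zero])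
  have h3 : S.f ≫ g = 0 := by rw [← cancel_epi p, h1, comp_zero]
  obtain ⟨e, rfl⟩ : ∃ e, S.g ≫ e = g := ⟨hS.desc g h3, hS.g_desc _ _⟩
  have : q ≫ e = 0 := by rw [← hr, Category.assoc, h2]
  rw [show e = 0 by rw [← cancel_epi q, this, comp_zero], comp_zero]

/-- A weak pullback. -/
def WeakPullbacks (M : FMod.{w} X) : Prop :=
  ∀ ⦃x y : X⦄ (f : rep.obj x ⟶ M) (g : rep.obj y ⟶ M), ∃ (z : X) (k : rep.obj z ⟶ rep.obj x)
    (l : rep.obj z ⟶ rep.obj y), k ≫ f = l ≫ g ∧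
      ∀ ⦃t : X⦄ (b : rep.obj t ⟶ rep.obj x) (c : rep.obj t ⟶ rep.obj y), b ≫ f = c ≫ g →
        ∃ d, d ≫ k = b

omit [EssentiallySmall.{w} X] in
lemma weakPullbacks {M : FMod.{w} X} (hM : ∀ ⦃x : X⦄ (f : rep.obj x ⟶ M),
    ∃ (z : X) (k : rep.obj z ⟶ rep.obj x), k ≫ f = 0 ∧
      ∀ ⦃y : X⦄ (b : rep.obj y ⟶ rep.obj x), b ≫ f = 0 → ∃ c, c ≫ k = b) :
    WeakPullbacks M := by
  intro x y f g
  obtain ⟨z, k, hk, hk'⟩ := hM (repDesc f (-g))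
  refine ⟨z, k ≫ rep.map biprod.fst, k ≫ rep.map biprod.snd, ?_, fun t b c h ↦ ?_⟩
  · rw [repDesc, Preadditive.comp_add, Preadditive.comp_neg, Preadditive.comp_neg,
      add_neg_eq_zero] at hk
    simpa using hk
  · obtain ⟨d, hd⟩ := hk' (b ≫ rep.map biprod.inl + c ≫ rep.map biprod.inr) (by
      rw [Preadditive.add_comp, Category.assoc, Category.assoc, inl_repDesc, inr_repDesc, h]; simp)
    refine ⟨d, ?_⟩
    rw [reassoc_of% hd, Preadditive.add_comp, Category.assoc, Category.assoc, ← rep.map_comp,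
      ← rep.map_comp]
    simp

-- Lift `f` to `f₀` with values in X₂. Then `b` dies in X₃ exactly when `b ≫ f₀` comes from a
-- representable covering X₁, so a weak pullback generates the kernel.
omit [EssentiallySmall.{w} X] [HasBinaryBiproducts X] in
lemma IsCoh.cokernel {S : ShortComplex (FMod.{w} X)} (hS : S.Exact) [Epi S.g] (h₁ : IsFG S.X₁)
    (h₂ : IsFG S.X₂) (h₂' : WeakPullbacks S.X₂) : IsCoh S.X₃ := by
  refine ⟨h₂.of_epi S.g, fun x f ↦ ?_⟩
  obtain ⟨f₀, hf₀⟩ := exists_lift_of_epi S.g f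
  obtain ⟨a, p, hp⟩ := h₁
  obtain ⟨z, k, l, hk, hk'⟩ := h₂' f₀ (p ≫ S.f)
  refine ⟨z, k, by rw [← hf₀, reassoc_of% hk, S.zero, comp_zero, comp_zero], fun y b hb ↦ ?_⟩
  obtain ⟨c, hc⟩ := exists_lift_of_exact hS (b ≫ f₀) (by rw [Category.assoc, hf₀, hb])
  obtain ⟨d, hd⟩ := exists_lift_of_epi p c
  exact hk' b d (by rw [← hc, reassoc_of% hd])

-- The kernel is generated in two stages: first the kernel of the composite to X₃, then the kernel
-- of the map this induces to X₁.
omit [EssentiallySmall.{w} X] in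
lemma IsCoh.extension {S : ShortComplex (FMod.{w} X)} (hS : S.ShortExact) (h₁ : IsCoh S.X₁)
    (h₃ : IsCoh S.X₃) : IsCoh S.X₂ := by
  have := hS.mono_f
  have := hS.epi_g
  refine ⟨isFG_of_exact hS.exact h₁.1 h₃.1, fun x f ↦ ?_⟩
  obtain ⟨z, k, hk, hk'⟩ := h₃.2 (f ≫ S.g)
  obtain ⟨m, hm⟩ := exists_lift_of_exact hS.exact (k ≫ f) (by rw [Category.assoc, hk])
  obtain ⟨z', k', hk₁, hk₂⟩ := h₁.2 m
  refine ⟨z', k' ≫ k, by rw [Category.assoc, ← hm, reassoc_of% hk₁, zero_comp], fun y b hb ↦ ?_⟩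
  obtain ⟨c, rfl⟩ := hk' b (by rw [reassoc_of% hb, zero_comp])
  obtain ⟨d, rfl⟩ := hk₂ c (by
    rw [← cancel_mono S.f, Category.assoc, hm, ← Category.assoc, hb, zero_comp])
  exact ⟨d, (Category.assoc _ _ _).symm⟩

omit [EssentiallySmall.{w} X] [HasBinaryBiproducts X] in
lemma isCoh_rep (hX : HasPseudokernels X) (x : X) : IsCoh (rep.obj x) := by
  refine ⟨isFG_rep x, fun y g ↦ ?_⟩
  obtain ⟨z, k, hk, ek⟩ := hX (repElt g : y ⟶ x)
  rw [rep_map_repElt] at hk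
  refine ⟨z, rep.map k, hk, fun y b hb ↦ ?_⟩
  exact exists_lift_of_exact ek b (by change b ≫ rep.map (repElt g) = 0; rwa [rep_map_repElt])

-- Pseudokernels make representables coherent, and cokernels inherit it. Together with
-- `IsCoh.finPres`, this lets coherent and finitely presented be used interchangeably.
omit [EssentiallySmall.{w} X] in
lemma isCoh_of_finPres (hX : HasPseudokernels X) {M : FMod.{w} X} (h : finPres X M) :
    IsCoh M := by
  obtain ⟨x₁, x₀, f, p, w, ex, hp⟩ := h
  exact IsCoh.cokernel (S := ShortComplex.mk f p w) ex (isFG_rep _) (isFG_rep _)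
    (weakPullbacks (isCoh_rep hX _).2)

end Coherent

/-! ### Maps from finitely generated functors to direct sums. -/

section Sigma

variable {J : Type w} (t : J → FMod.{w} X)

open Classical in
/-- The projection of a direct sum to one of its summands. -/
def sigmaπ (j : J) : ∐ t ⟶ t j := Sigma.desc fun i ↦ if h : i = j then eqToHom (by rw [h]) else 0

lemma ι_sigmaπ_self (j : J) : Sigma.ι t j ≫ sigmaπ t j = 𝟙 _ := by simp [sigmaπ]

lemma ι_sigmaπ_of_ne {i j : J} (h : i ≠ j) : Sigma.ι t i ≫ sigmaπ t j = 0 := by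
  simp [sigmaπ, h]

open Classical in
/-- The morphism is a finite sum of morphisms that factor through one summand. -/
def IsFiniteSum {M : FMod.{w} X} (f : M ⟶ ∐ t) : Prop :=
  ∃ s : Finset J, ∀ s' : Finset J, s ⊆ s' → f = ∑ i ∈ s', f ≫ sigmaπ t i ≫ Sigma.ι t i

variable {t}

lemma IsFiniteSum.of_epi {M N : FMod.{w} X} {p : M ⟶ N} [Epi p] {f : N ⟶ ∐ t}
    (h : IsFiniteSum t (p ≫ f)) : IsFiniteSum t f := by
  obtain ⟨s, hs⟩ := h
  refine ⟨s, fun s' h ↦ ?_⟩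
  rw [← cancel_epi p, Preadditive.comp_sum, hs s' h]
  simp only [Category.assoc]

lemma IsFiniteSum.add {M : FMod.{w} X} {f g : M ⟶ ∐ t} (hf : IsFiniteSum t f)
    (hg : IsFiniteSum t g) : IsFiniteSum t (f + g) := by
  classical
  obtain ⟨s, hs⟩ := hf
  obtain ⟨s', hs'⟩ := hg
  refine ⟨s ∪ s', fun r hr ↦ ?_⟩
  simp only [Preadditive.add_comp, Finset.sum_add_distrib]
  rw [← hs r (Finset.union_subset_left hr), ← hs' r (Finset.union_subset_right hr)]

lemma IsFiniteSum.neg {M : FMod.{w} X} {f : M ⟶ ∐ t} (hf : IsFiniteSum t f) :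
    IsFiniteSum t (-f) := by
  obtain ⟨s, hs⟩ := hf
  refine ⟨s, fun r hr ↦ ?_⟩
  simp only [Preadditive.neg_comp, Finset.sum_neg_distrib]
  rw [← hs r hr]

lemma isFiniteSum_ι {M : FMod.{w} X} {j : J} (f : M ⟶ t j) : IsFiniteSum t (f ≫ Sigma.ι t j) := by
  classical
  refine ⟨{j}, fun r hr ↦ ?_⟩
  rw [Finset.sum_eq_single_of_mem j (hr (by simp)), Category.assoc, reassoc_of% @ι_sigmaπ_self]
  intro i _ hi
  rw [Category.assoc, reassoc_of% ι_sigmaπ_of_ne t hi.symm, zero_comp, comp_zero]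

lemma repLift_add {x : X} {M : FMod.{w} X} (a b : M.obj.obj (.op x)) :
    repLift (a + b) = repLift a + repLift b :=
  repElt_injective ((repElt_repLift _).trans
    (congrArg₂ (· + ·) (repElt_repLift a) (repElt_repLift b)).symm)

lemma repLift_neg {x : X} {M : FMod.{w} X} (a : M.obj.obj (.op x)) :
    repLift (-a) = -repLift a :=
  repElt_injective ((repElt_repLift _).trans (congrArg Neg.neg (repElt_repLift a)).symm)

/-- Evaluation at `x` preserves coproducts. The elements given by finite sums form a subgroup
containing the image of every summand, so the quotient by it vanishes. -/
lemma isFiniteSum_rep {x : X} (f : rep.obj x ⟶ ∐ t) : IsFiniteSum t f := by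
  let H : AddSubgroup ((∐ t).obj.obj (.op x)) :=
    { carrier := {a | IsFiniteSum t (repLift a)}
      add_mem' := fun {a b} ha hb ↦ by
        change IsFiniteSum t (repLift (a + b))
        rw [repLift_add]; exact IsFiniteSum.add ha hb
      zero_mem' := by
        have h : IsFiniteSum t (0 : rep.obj x ⟶ ∐ t) := ⟨∅, by simp⟩
        have : (repLift 0 : rep.obj x ⟶ ∐ t) = 0 := repElt_injective (repElt_repLift _)
        change IsFiniteSum t (repLift 0)
        rwa [this]
      neg_mem' := fun {a} ha ↦ by
        change IsFiniteSum t (repLift (-a))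
        rw [repLift_neg]; exact IsFiniteSum.neg ha }
  let ev : FMod.{w} X ⥤ AddCommGrpCat.{w} :=
    (additiveFunctor Xᵒᵖ AddCommGrpCat.{w}).ι ⋙ (evaluation _ _).obj (.op x)
  have : PreservesColimit (Discrete.functor t) ev := inferInstance
  have hc := isColimitOfPreserves ev (colimit.isColimit (Discrete.functor t))
  have key : AddCommGrpCat.ofHom (QuotientAddGroup.mk' H) =
      (AddCommGrpCat.ofHom 0 : ev.obj (∐ t) ⟶ .of (_ ⧸ H)) := by
    refine hc.hom_ext fun ⟨j⟩ ↦ ?_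
    ext a
    refine (QuotientAddGroup.eq_zero_iff _).2 ?_
    change IsFiniteSum t _
    have : IsFiniteSum t (repLift a ≫ Sigma.ι t j) := isFiniteSum_ι _
    convert this
    refine repElt_injective ((repElt_repLift _).trans ?_)
    exact (congrArg ((Sigma.ι t j).hom.app (.op x)) (repElt_repLift a)).symm
  have h := (QuotientAddGroup.eq_zero_iff _).1 (ConcreteCategory.congr_hom key (repElt f))
  have h' : IsFiniteSum t (repLift (repElt f)) := h
  have e : repLift (repElt f) = f := repEquiv.left_inv f
  rwa [e] at h'

lemma IsFG.isFiniteSum {M : FMod.{w} X} (hM : IsFG M) (f : M ⟶ ∐ t) : IsFiniteSum t f := by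
  obtain ⟨x, p, hp⟩ := hM
  exact (isFiniteSum_rep (p ≫ f)).of_epi

end Sigma

end Representables

/-! ### Coinduced functors and enough injectives. -/

section Injectives

variable {X : Type u} [Category.{w} X] [Preadditive X]

lemma mono_app {M N : FMod.{w} X} (f : M ⟶ N) [Mono f] (x : Xᵒᵖ) : Mono (f.hom.app x) := by
  rw [AddCommGrpCat.mono_iff_injective, injective_iff_map_eq_zero]
  intro a ha
  have h1 : (repLift a : rep.obj x.unop ⟶ M) ≫ f = 0 := by
    apply repElt_injective
    rw [repElt_comp, repElt_repLift]
    exact ha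
  have h2 : (repLift a : rep.obj x.unop ⟶ M) = 0 := by rw [← cancel_mono f, h1, zero_comp]
  exact (repElt_repLift a).symm.trans (congrArg repElt h2)

/-- The functor `x ↦ Hom(X(c, x), E)`. -/
def coind (c : X) (E : AddCommGrpCat.{w}) : FMod.{w} X :=
  ⟨(preadditiveCoyoneda.obj (.op c)).op ⋙ preadditiveYoneda.obj E, by
    have : (preadditiveCoyoneda.obj (.op c) : X ⥤ AddCommGrpCat.{w}).Additive := inferInstance
    exact inferInstanceAs (Functor.Additive
      ((preadditiveCoyoneda.obj (.op c)).op ⋙ preadditiveYoneda.obj E))⟩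

/-- The value of an element of a coinduced functor. -/
def coindApp {c : X} {E : AddCommGrpCat.{w}} {x : Xᵒᵖ} (k : (coind c E).obj.obj x)
    (h : c ⟶ x.unop) : E :=
  (show AddCommGrpCat.of (c ⟶ x.unop) ⟶ E from k).hom h

lemma coindApp_ext {c : X} {E : AddCommGrpCat.{w}} {x : Xᵒᵖ} {k l : (coind c E).obj.obj x}
    (h : ∀ h, coindApp k h = coindApp l h) : k = l :=
  AddCommGrpCat.hom_ext (AddMonoidHom.ext h)

/-- The morphism to a coinduced functor given by a homomorphism of abelian groups. -/
def coindLift {M : FMod.{w} X} {c : X} {E : AddCommGrpCat.{w}} (l : M.obj.obj (.op c) ⟶ E) :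
    M ⟶ coind c E :=
  ObjectProperty.homMk
    { app x := AddCommGrpCat.ofHom (AddMonoidHom.mk'
        (fun m ↦ (AddCommGrpCat.ofHom (AddMonoidHom.mk' (fun h : c ⟶ x.unop ↦ l (M.obj.map h.op m))
          fun h h' ↦ by
            have := ConcreteCategory.congr_hom (M.obj.map_add (f := h.op) (g := h'.op)) m
            exact (congrArg l this).trans (l.hom.map_add _ _)) :
              AddCommGrpCat.of (c ⟶ x.unop) ⟶ E))
        fun m m' ↦ by
          refine coindApp_ext fun h ↦ ?_
          change l (M.obj.map (Quiver.Hom.op h) (m + m')) = _ + _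
          rw [map_add, map_add]
          rfl)
      naturality x y f := by
        ext m
        refine coindApp_ext fun h ↦ ?_
        change l (M.obj.map h.op (M.obj.map f m)) = l (M.obj.map (h ≫ f.unop).op m)
        rw [op_comp, M.obj.map_comp]
        rfl }

/-- The homomorphism given by a morphism to a coinduced functor. -/
def coindElt {M : FMod.{w} X} {c : X} {E : AddCommGrpCat.{w}} (f : M ⟶ coind c E) :
    M.obj.obj (.op c) ⟶ E :=
  f.hom.app (.op c) ≫ AddCommGrpCat.ofHom (AddMonoidHom.mk'
    (fun k : (coind c E).obj.obj (.op c) ↦ coindApp k (𝟙 c)) fun _ _ ↦ rfl)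

lemma coindElt_coindLift {M : FMod.{w} X} {c : X} {E : AddCommGrpCat.{w}}
    (l : M.obj.obj (.op c) ⟶ E) : coindElt (coindLift l) = l := by
  ext m
  change l (M.obj.map (𝟙 c).op m) = l m
  rw [op_id, M.obj.map_id]
  rfl

lemma coindElt_comp {M N : FMod.{w} X} {c : X} {E : AddCommGrpCat.{w}} (g : M ⟶ N)
    (f : N ⟶ coind c E) : coindElt (g ≫ f) = g.hom.app (.op c) ≫ coindElt f := rfl

lemma coindElt_injective {M : FMod.{w} X} {c : X} {E : AddCommGrpCat.{w}} :
    Function.Injective (coindElt : (M ⟶ coind c E) → _) := by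
  intro f g hfg
  ext x m
  refine coindApp_ext fun h ↦ ?_
  have key : ∀ f : M ⟶ coind c E, coindApp (f.hom.app x m) h = coindElt f (M.obj.map h.op m) :=
    fun f ↦ by
      have h1 := ConcreteCategory.congr_hom (f.hom.naturality h.op) m
      have h2 : coindApp (f.hom.app (.op c) (M.obj.map h.op m)) (𝟙 c) =
          coindApp (f.hom.app x m) (𝟙 c ≫ h) := congrArg (coindApp · (𝟙 c)) h1
      rw [Category.id_comp] at h2
      exact h2.symm
  exact (key f).trans ((ConcreteCategory.congr_hom hfg _).trans (key g).symm)

instance injective_coind (c : X) (E : AddCommGrpCat.{w}) [Injective E] :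
    Injective (coind c E) where
  factors g f _ := by
    have := mono_app f (.op c)
    refine ⟨coindLift (Injective.factorThru (coindElt g) (f.hom.app (.op c))), ?_⟩
    apply coindElt_injective
    rw [coindElt_comp, coindElt_coindLift, Injective.comp_factorThru]

/-- Maps to `coind c E` are homomorphisms M(c) → E, so embeddings of all the M(c) in injective
groups combine to an embedding of M in a product of injectives. -/
instance enoughInjectivesMod {C : Type w} [SmallCategory.{w} C] [Preadditive C] :
    EnoughInjectives (FMod.{w} C) where
  presentation M := by
    let i : M ⟶ ∏ᶜ fun c : C ↦ coind c (Injective.under (M.obj.obj (.op c))) :=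
      Pi.lift fun c ↦ coindLift (Injective.ι _)
    have : Mono i := by
      refine mono_of_rep _ fun x b hb ↦ ?_
      have h1 : b ≫ coindLift (Injective.ι (M.obj.obj (.op x))) = 0 := by
        have := congrArg (· ≫ Pi.π _ x) hb
        simpa [i] using this
      have h2 : Injective.ι (M.obj.obj (.op x)) (repElt b) = 0 := by
        have h3 := congrArg coindElt h1
        rw [coindElt_comp, coindElt_coindLift] at h3
        exact ConcreteCategory.congr_hom h3 (𝟙 x : x ⟶ x)
      have h4 := (AddCommGrpCat.mono_iff_injective (Injective.ι (M.obj.obj (.op x)))).1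
        inferInstance
      exact repElt_injective (h4 (h2.trans (map_zero _).symm))
    exact ⟨{ J := _, injective := inferInstance, f := i, mono := this }⟩

end Injectives

/-! ### The long exact sequence of F and F'. -/

section Restricted

variable {C : Type w} [SmallCategory.{w} C] [Preadditive C] (T : ObjectProperty (FMod.{w} C))

open Abelian

section

variable {T} {t : T.FullSubcategory} {M N : FMod.{w} C}

/-- The morphism `T( , t) ⟶ F(M)` given by a morphism `t ⟶ M`. -/
def toF (f : t.obj ⟶ M) : rep.obj t ⟶ (F T).obj M := repLift (M := (F T).obj M) f

/-- The morphism `t ⟶ M` given by a morphism `T( , t) ⟶ F(M)`. -/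
def ofF (b : rep.obj t ⟶ (F T).obj M) : t.obj ⟶ M := repElt b

lemma ofF_toF (f : t.obj ⟶ M) : ofF (toF f) = f := repElt_repLift (M := (F T).obj M) f

lemma ofF_injective : Function.Injective (ofF : (rep.obj t ⟶ (F T).obj M) → _) :=
  repElt_injective

lemma toF_ofF (b : rep.obj t ⟶ (F T).obj M) : toF (ofF b) = b := ofF_injective (ofF_toF _)

lemma ofF_comp_map (b : rep.obj t ⟶ (F T).obj M) (g : M ⟶ N) :
    ofF (b ≫ (F T).map g) = ofF b ≫ g := rfl

lemma toF_comp_map (f : t.obj ⟶ M) (g : M ⟶ N) : toF f ≫ (F T).map g = toF (f ≫ g) :=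
  ofF_injective (by rw [ofF_comp_map, ofF_toF, ofF_toF])

lemma ofF_zero : ofF (0 : rep.obj t ⟶ (F T).obj M) = 0 := rfl

lemma ofF_eq_zero {b : rep.obj t ⟶ (F T).obj M} (h : ofF b = 0) : b = 0 := ofF_injective h

lemma repElt_naturality {X : Type u} [Category.{w} X] [Preadditive X] {x y : X} {M : FMod.{w} X}
    (u : x ⟶ y) (b : rep.obj y ⟶ M) : repElt (rep.map u ≫ b) = M.obj.map u.op (repElt b) := by
  have := ConcreteCategory.congr_hom (b.hom.naturality u.op) (𝟙 y : y ⟶ y)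
  refine Eq.trans ?_ this
  change b.hom.app _ (𝟙 x ≫ u) = b.hom.app _ (u ≫ 𝟙 y)
  rw [Category.id_comp, Category.comp_id]

lemma ofF_map_comp {s : T.FullSubcategory} (u : s ⟶ t) (b : rep.obj t ⟶ (F T).obj M) :
    ofF (rep.map u ≫ b) = u.hom ≫ ofF b := repElt_naturality u b

lemma map_comp_toF {s : T.FullSubcategory} (u : s ⟶ t) (f : t.obj ⟶ M) :
    rep.map u ≫ toF f = toF (u.hom ≫ f) :=
  ofF_injective (by rw [ofF_map_comp, ofF_toF, ofF_toF])

/-- The morphism `T( , t) ⟶ F'(M)` given by an extension. -/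
def toF' (e : Ext t.obj M 1) : rep.obj t ⟶ (F' T).obj M := repLift (M := (F' T).obj M) e

/-- The extension given by a morphism `T( , t) ⟶ F'(M)`. -/
def ofF' (b : rep.obj t ⟶ (F' T).obj M) : Ext t.obj M 1 := repElt b

lemma ofF'_toF' (e : Ext t.obj M 1) : ofF' (toF' e) = e := repElt_repLift (M := (F' T).obj M) e

lemma ofF'_injective : Function.Injective (ofF' : (rep.obj t ⟶ (F' T).obj M) → _) :=
  repElt_injective

lemma ofF'_comp_map (b : rep.obj t ⟶ (F' T).obj M) (g : M ⟶ N) :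
    ofF' (b ≫ (F' T).map g) = (ofF' b).comp (Ext.mk₀ g) (add_zero 1) := rfl

lemma ofF'_zero : ofF' (0 : rep.obj t ⟶ (F' T).obj M) = 0 := rfl

end

/-- The connecting morphism `Hom( , X₃) ⟶ Ext¹( , X₁)` of a short exact sequence. -/
def homδ {S : ShortComplex (FMod.{w} C)} (hS : S.ShortExact) :
    (F T).obj S.X₃ ⟶ (F' T).obj S.X₁ :=
  ObjectProperty.homMk
    { app t := AddCommGrpCat.ofHom (AddMonoidHom.mk'
        (fun f : t.unop.obj ⟶ S.X₃ ↦
          ((Ext.mk₀ f).comp hS.extClass (zero_add 1) : Ext t.unop.obj S.X₁ 1))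
        fun (f g : t.unop.obj ⟶ S.X₃) ↦
          (congrArg (Ext.comp · hS.extClass (zero_add 1)) (Ext.mk₀_add f g)).trans
            (Ext.add_comp _ _ _ _))
      naturality s t u := by
        refine AddCommGrpCat.hom_ext (AddMonoidHom.ext fun (f : s.unop.obj ⟶ S.X₃) ↦ ?_)
        exact (Ext.mk₀_comp_mk₀_assoc u.unop.hom f hS.extClass).symm }

lemma ofF'_homδ {S : ShortComplex (FMod.{w} C)} (hS : S.ShortExact) {t : T.FullSubcategory}
    (b : rep.obj t ⟶ (F T).obj S.X₃) :
    ofF' (b ≫ homδ T hS) = (Ext.mk₀ (ofF b)).comp hS.extClass (zero_add 1) := rfl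

variable [EssentiallySmall.{w} T.FullSubcategory]

lemma homδ_naturality {S S' : ShortComplex (FMod.{w} C)} (hS : S.ShortExact)
    (hS' : S'.ShortExact) (φ : S ⟶ S') :
    (F T).map φ.τ₃ ≫ homδ T hS' = homδ T hS ≫ (F' T).map φ.τ₁ := by
  refine hom_ext_rep fun t b ↦ ofF'_injective ?_
  rw [← Category.assoc, ← Category.assoc, ofF'_homδ, ofF'_comp_map, ofF'_homδ, ofF_comp_map,
    ← Ext.mk₀_comp_mk₀, Ext.comp_assoc_of_second_deg_zero, Ext.comp_assoc_of_third_deg_zero,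
    ShortComplex.ShortExact.extClass_naturality]

section Exactness

variable {S : ShortComplex (FMod.{w} C)} (hS : S.ShortExact)

lemma map_comp_homδ : (F T).map S.g ≫ homδ T hS = 0 := by
  refine hom_ext_rep fun t b ↦ ofF'_injective ?_
  rw [← Category.assoc, ofF'_homδ, ofF_comp_map, comp_zero, ofF'_zero, ← Ext.mk₀_comp_mk₀,
    Ext.comp_assoc_of_second_deg_zero, hS.comp_extClass, Ext.comp_zero]

lemma homδ_comp_map : homδ T hS ≫ (F' T).map S.f = 0 := by
  refine hom_ext_rep fun t b ↦ ofF'_injective ?_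
  rw [← Category.assoc, ofF'_comp_map, ofF'_homδ, comp_zero, ofF'_zero,
    Ext.comp_assoc_of_third_deg_zero, hS.extClass_comp, Ext.comp_zero]

lemma F'_map_comp_map : (F' T).map S.f ≫ (F' T).map S.g = 0 := by
  refine hom_ext_rep fun t b ↦ ofF'_injective ?_
  rw [← Category.assoc, ofF'_comp_map, ofF'_comp_map, comp_zero, ofF'_zero,
    Ext.comp_assoc_of_second_deg_zero, Ext.mk₀_comp_mk₀, S.zero, Ext.mk₀_zero, Ext.comp_zero]

omit [EssentiallySmall.{w} T.FullSubcategory] in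
lemma F_map_comp_map (S : ShortComplex (FMod.{w} C)) : (F T).map S.f ≫ (F T).map S.g = 0 := by
  rw [← Functor.map_comp, S.zero, Functor.map_zero]

instance mono_F_map {M N : FMod.{w} C} (i : M ⟶ N) [Mono i] : Mono ((F T).map i) :=
  mono_of_rep _ fun t b hb ↦ ofF_eq_zero (by
    rw [← cancel_mono i, ← ofF_comp_map, hb, ofF_zero, zero_comp])

include hS in
lemma exact_F : (ShortComplex.mk _ _ (F_map_comp_map T S)).Exact := by
  have := hS.mono_f
  refine exact_of_rep fun t (b : _ ⟶ (F T).obj S.X₂) hb ↦ ?_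
  have h : ofF b ≫ S.g = 0 := congrArg ofF hb
  refine ⟨toF (hS.exact.lift (ofF b) h), ?_⟩
  change _ ≫ (F T).map S.f = b
  rw [toF_comp_map, hS.exact.lift_f, toF_ofF]

lemma exact_F_homδ : (ShortComplex.mk _ _ (map_comp_homδ T hS)).Exact := by
  refine exact_of_rep fun t (b : _ ⟶ (F T).obj S.X₃) hb ↦ ?_
  obtain ⟨e, he⟩ := Ext.covariant_sequence_exact₃ _ hS (Ext.mk₀ (ofF b)) (zero_add 1)
    (congrArg ofF' hb)
  obtain ⟨f, rfl⟩ := (Ext.mk₀_bijective _ _).2 e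
  refine ⟨toF f, ?_⟩
  rw [Ext.mk₀_comp_mk₀] at he
  change _ ≫ (F T).map S.g = b
  rw [toF_comp_map, (Ext.mk₀_bijective _ _).1 he, toF_ofF]

lemma exact_homδ_F' : (ShortComplex.mk _ _ (homδ_comp_map T hS)).Exact := by
  refine exact_of_rep fun t (b : _ ⟶ (F' T).obj S.X₁) hb ↦ ?_
  obtain ⟨e, he⟩ := Ext.covariant_sequence_exact₁ _ hS (ofF' b) (congrArg ofF' hb) (zero_add 1)
  obtain ⟨f, rfl⟩ := (Ext.mk₀_bijective _ _).2 e
  refine ⟨toF f, ofF'_injective ?_⟩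
  change ofF' (_ ≫ homδ T hS) = ofF' b
  rw [ofF'_homδ, ofF_toF, he]

include hS in
lemma exact_F' : (ShortComplex.mk _ _ (F'_map_comp_map T (S := S))).Exact := by
  refine exact_of_rep fun t (b : _ ⟶ (F' T).obj S.X₂) hb ↦ ?_
  obtain ⟨e, he⟩ := Ext.covariant_sequence_exact₂ _ hS (ofF' b) (congrArg ofF' hb)
  refine ⟨toF' e, ofF'_injective ?_⟩
  change ofF' (_ ≫ (F' T).map S.f) = ofF' b
  rw [ofF'_comp_map, ofF'_toF', he]

variable {T} (hT : IsTilting T)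
include hT

-- The next term of the sequence is Ext², which vanishes on `T` by the bound on projective
-- dimension. So F' is right exact.
include hS in
lemma epi_F' : Epi ((F' T).map S.g) := by
  refine epi_of_rep _ fun t b ↦ ?_
  have := hT.projectiveDimension_le_one _ t.property
  obtain ⟨e, he⟩ := Ext.covariant_sequence_exact₃ _ hS (ofF' b) (rfl : 1 + 1 = 2)
    (HasProjectiveDimensionLT.subsingleton t.obj 2 2 le_rfl _ |>.elim _ _)
  exact ⟨toF' e, ofF'_injective (by rw [ofF'_comp_map, ofF'_toF', he])⟩

end Exactness

lemma isZero_of_rep {X : Type u} [Category.{w} X] [Preadditive X] [EssentiallySmall.{w} X]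
    {M : FMod.{w} X} (h : ∀ (x : X) (b : rep.obj x ⟶ M), b = 0) : IsZero M := by
  rw [IsZero.iff_id_eq_zero]
  exact hom_ext_rep fun x b ↦ by rw [h x b, zero_comp, zero_comp]

lemma isZero_F'_iff (M : FMod.{w} C) :
    IsZero ((F' T).obj M) ↔ ∀ (t : FMod.{w} C), T t → ∀ e : Ext t M 1, e = 0 := by
  refine ⟨fun h t ht e ↦ ?_, fun h ↦ isZero_of_rep fun t b ↦ ofF'_injective (h _ t.property _)⟩
  have := h.eq_zero_of_tgt (toF' (t := ⟨t, ht⟩) e)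
  rw [← ofF'_toF' (t := ⟨t, ht⟩) e, this, ofF'_zero]

lemma isZero_F_iff (M : FMod.{w} C) :
    IsZero ((F T).obj M) ↔ ∀ (t : FMod.{w} C), T t → ∀ e : t ⟶ M, e = 0 := by
  refine ⟨fun h t ht e ↦ ?_, fun h ↦ isZero_of_rep fun t b ↦ ofF_injective (h _ t.property _)⟩
  have := h.eq_zero_of_tgt (toF (t := ⟨t, ht⟩) e)
  rw [← ofF_toF (t := ⟨t, ht⟩) e, this, ofF_zero]

lemma isZero_F'_of_injective (M : FMod.{w} C) [Injective M] : IsZero ((F' T).obj M) :=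
  (isZero_F'_iff T M).2 fun _ _ e ↦ Ext.eq_zero_of_injective e

lemma isZero_F'_of_epi {T : ObjectProperty (FMod.{w} C)} [EssentiallySmall.{w} T.FullSubcategory]
    (hT : IsTilting T) {M N : FMod.{w} C} (p : M ⟶ N) [Epi p]
    (h : IsZero ((F' T).obj M)) : IsZero ((F' T).obj N) := by
  have := epi_F' (shortExact_kernel p) hT
  exact IsZero.of_epi ((F' T).map p) h

end Restricted

/-! ### Direct sums of objects of `T` and the torsion pair. -/

section Tilting

variable {C : Type w} [SmallCategory.{w} C] [Preadditive C] {T : ObjectProperty (FMod.{w} C)}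

open Abelian

lemma isFG_of_finPres {X : Type u} [Category.{w} X] [Preadditive X] {M : FMod.{w} X}
    (h : finPres X M) : IsFG M := by
  obtain ⟨_, x, _, p, _, _, hp⟩ := h
  exact ⟨x, p, hp⟩

lemma projective_sigma_rep {X : Type u} [Category.{w} X] [Preadditive X] {J : Type w} (t : J → X) :
    Projective (∐ fun j ↦ rep.obj (t j)) :=
  ⟨fun g e _ ↦ ⟨Sigma.desc fun j ↦
    Projective.factorThru (Sigma.ι (fun j ↦ rep.obj (t j)) j ≫ g) e,
    Sigma.hom_ext _ _ fun j ↦ by simp⟩⟩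

section

variable (T) {J : Type w} (t : J → T.FullSubcategory)

/-- The comparison morphism from a sum of representable functors to `F` of a sum. -/
def sigmaComparison : (∐ fun j ↦ rep.obj (t j)) ⟶ (F T).obj (∐ fun j ↦ (t j).obj) :=
  Sigma.desc fun j ↦ toF (Sigma.ι (fun j ↦ (t j).obj) j)

lemma ι_sigmaComparison (j : J) : Sigma.ι (fun j ↦ rep.obj (t j)) j ≫ sigmaComparison T t =
    toF (Sigma.ι (fun j ↦ (t j).obj) j) := by simp [sigmaComparison]

lemma sigmaComparison_map_π (j : J) :
    sigmaComparison T t ≫ (F T).map (sigmaπ (fun j ↦ (t j).obj) j) =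
      sigmaπ (fun j ↦ rep.obj (t j)) j ≫ toF (𝟙 (t j).obj) := by
  refine Sigma.hom_ext _ _ fun i ↦ ?_
  rw [reassoc_of% @ι_sigmaComparison, toF_comp_map]
  by_cases h : i = j
  · subst h
    rw [ι_sigmaπ_self, reassoc_of% @ι_sigmaπ_self]
  · rw [ι_sigmaπ_of_ne _ h, reassoc_of% ι_sigmaπ_of_ne _ h, zero_comp]
    exact ofF_injective (ofF_toF _)

variable [EssentiallySmall.{w} T.FullSubcategory]

variable {T}

/-- Surjectivity: objects of `T` are finitely generated, so a map from one into the sum is a finite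
sum of components, each a morphism of `T`. Injectivity is checked on components, finitely many of
which determine a map from a representable. -/
lemma isIso_sigmaComparison (hT : IsTilting T) : IsIso (sigmaComparison T t) := by
  have : Mono (sigmaComparison T t) := by
    refine mono_of_rep _ fun s b hb ↦ ?_
    obtain ⟨r, hr⟩ := isFiniteSum_rep b
    rw [hr r subset_rfl]
    refine Finset.sum_eq_zero fun j _ ↦ ?_
    have h1 : (b ≫ sigmaπ (fun j ↦ rep.obj (t j)) j) ≫ toF (𝟙 (t j).obj) = 0 := by
      rw [Category.assoc, ← sigmaComparison_map_π, reassoc_of% hb, zero_comp]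
    have h2 : b ≫ sigmaπ (fun j ↦ rep.obj (t j)) j = 0 := by
      obtain ⟨u, hu⟩ : ∃ u : s ⟶ t j, rep.map u = b ≫ sigmaπ (fun j ↦ rep.obj (t j)) j :=
        ⟨_, rep_map_repElt _⟩
      rw [← hu, map_comp_toF, Category.comp_id] at h1
      have h3 : u.hom = 0 := by rw [← ofF_toF u.hom, h1, ofF_zero]
      have h4 : u = 0 := by ext1; exact h3
      rw [← hu, h4, Functor.map_zero]
    rw [reassoc_of% h2, zero_comp]
  have : Epi (sigmaComparison T t) := by
    refine epi_of_rep _ fun s b ↦ ?_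
    obtain ⟨r, hr⟩ := (isFG_of_finPres (hT.finPres _ s.property)).isFiniteSum (ofF b)
    let u (j : J) : s ⟶ t j := ObjectProperty.homMk (ofF b ≫ sigmaπ _ j)
    refine ⟨∑ j ∈ r, rep.map (u j) ≫ Sigma.ι (fun j ↦ rep.obj (t j)) j, ?_⟩
    rw [Preadditive.sum_comp]
    simp only [Category.assoc, ι_sigmaComparison, map_comp_toF]
    have h1 : ∀ j, (u j).hom ≫ Sigma.ι (fun j ↦ (t j).obj) j =
        ofF b ≫ sigmaπ (fun j ↦ (t j).obj) j ≫ Sigma.ι (fun j ↦ (t j).obj) j :=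
      fun j ↦ Category.assoc _ _ _
    simp only [h1]
    have h2 := hr r subset_rfl
    let φ : (s.obj ⟶ ∐ fun j ↦ (t j).obj) →+ (rep.obj s ⟶ (F T).obj (∐ fun j ↦ (t j).obj)) :=
      AddMonoidHom.mk' toF fun f g ↦ repLift_add (M := (F T).obj _) f g
    have h3 := congrArg φ h2
    rw [map_sum] at h3
    exact h3.symm.trans (toF_ofF b)
  exact isIso_of_mono_of_epi _

/-- The transpose of the comparison morphism. -/
def sigmaComparison' :
    (G T).obj (∐ fun j ↦ rep.obj (t j)) ⟶ ∐ fun j ↦ (t j).obj :=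
  ((adjunction T).homEquiv _ _).symm (sigmaComparison T t)

lemma unit_map_sigmaComparison' :
    (adjunction T).unit.app (∐ fun j ↦ rep.obj (t j)) ≫ (F T).map (sigmaComparison' t) =
      sigmaComparison T t :=
  ((adjunction T).homEquiv_unit _ _ _).symm.trans (Equiv.apply_symm_apply _ _)

instance isIso_sigmaComparison' : IsIso (sigmaComparison' t) := by
  let inv : (∐ fun j ↦ (t j).obj) ⟶ (G T).obj (∐ fun j ↦ rep.obj (t j)) :=
    Sigma.desc fun j ↦ ofF (Sigma.ι (fun j ↦ rep.obj (t j)) j ≫ (adjunction T).unit.app _)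
  refine ⟨inv, ?_, ?_⟩
  · apply ((adjunction T).homEquiv _ _).injective
    rw [sigmaComparison', Adjunction.homEquiv_naturality_right, Equiv.apply_symm_apply]
    refine Sigma.hom_ext _ _ fun j ↦ ?_
    rw [reassoc_of% @ι_sigmaComparison, toF_comp_map, Sigma.ι_desc, toF_ofF, Adjunction.homEquiv_id]
    rfl
  · refine Sigma.hom_ext _ _ fun j ↦ ?_
    rw [Sigma.ι_desc_assoc, ← ofF_comp_map, Category.assoc]
    rw [Category.comp_id]
    refine (congrArg (fun k ↦ ofF (Sigma.ι (fun j ↦ rep.obj (t j)) j ≫ k))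
      (unit_map_sigmaComparison' t)).trans ?_
    rw [ι_sigmaComparison, ofF_toF]

lemma isIso_unit_sigma (hT : IsTilting T) :
    IsIso ((adjunction T).unit.app (∐ fun j ↦ rep.obj (t j))) := by
  have h := unit_map_sigmaComparison' t
  have := isIso_sigmaComparison t hT
  have : IsIso ((adjunction T).unit.app (∐ fun j ↦ rep.obj (t j)) ≫
      (F T).map (sigmaComparison' t)) := by
    rw [h]; infer_instance
  exact IsIso.of_isIso_comp_right _ ((F T).map (sigmaComparison' t))

lemma isIso_counit_sigma (hT : IsTilting T) :
    IsIso ((adjunction T).counit.app (∐ fun j ↦ (t j).obj)) := by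
  have h : (G T).map (sigmaComparison T t) ≫ (adjunction T).counit.app _ = sigmaComparison' t := by
    rw [sigmaComparison', Adjunction.homEquiv_counit]
  have := isIso_sigmaComparison t hT
  have : IsIso ((G T).map (sigmaComparison T t) ≫ (adjunction T).counit.app _) := by
    rw [h]; infer_instance
  exact IsIso.of_isIso_comp_left ((G T).map (sigmaComparison T t)) _

lemma projective_F_sigma (hT : IsTilting T) : Projective ((F T).obj (∐ fun j ↦ (t j).obj)) :=
  have := isIso_sigmaComparison t hT
  Projective.of_iso (asIso (sigmaComparison T t)) (projective_sigma_rep t)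

/-- An extension of `s` by the sum is induced by a map `k` from the kernel of a projective
presentation of `s`. That kernel is finitely generated, so `k` is a finite sum of maps through
single summands, each contributing a class that factors through Ext¹(s, t j) = 0. -/
lemma isZero_F'_sigma (hT : IsTilting T) : IsZero ((F' T).obj (∐ fun j ↦ (t j).obj)) := by
  rw [isZero_F'_iff]
  intro s hs e
  obtain ⟨x₁, x₀, f, p, w, ex, hp⟩ := hT.finPres _ hs
  have hS := shortExact_kernel p
  have fg : IsFG (kernel p) := ⟨x₁, kernel.lift p f w, ex.epi_kernelLift⟩
  obtain ⟨e, rfl⟩ := Ext.contravariant_sequence_exact₃ hS _ e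
    (Ext.eq_zero_of_projective (P := rep.obj x₀) _) (n₀ := 0) rfl
  obtain ⟨k, rfl⟩ := (Ext.mk₀_bijective _ _).2 e
  obtain ⟨r, hr⟩ := fg.isFiniteSum k
  let φ : (kernel p ⟶ ∐ fun j ↦ (t j).obj) →+ Ext s (∐ fun j ↦ (t j).obj) 1 :=
    AddMonoidHom.mk' (fun k ↦ hS.extClass.comp (Ext.mk₀ k) (add_zero 1)) fun f g ↦ by
      rw [Ext.mk₀_add, Ext.comp_add]
  change φ k = 0
  rw [hr r subset_rfl, map_sum]
  refine Finset.sum_eq_zero fun j _ ↦ ?_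
  have h1 : hS.extClass.comp (Ext.mk₀ (k ≫ sigmaπ _ j)) (add_zero 1) = 0 :=
    (hT.ext_one_eq_zero s _ hs (t j).property).elim _ _
  change hS.extClass.comp (Ext.mk₀ _) (add_zero 1) = 0
  rw [← Category.assoc, ← Ext.mk₀_comp_mk₀, ← Ext.comp_assoc_of_second_deg_zero, h1, Ext.zero_comp]

end

variable [EssentiallySmall.{w} T.FullSubcategory] (hT : IsTilting T)

section Approximation

/-- The index type of the canonical morphism from a sum of objects of `T` to `M`. -/
abbrev approxIndex (T : ObjectProperty (FMod.{w} C)) [EssentiallySmall.{w} T.FullSubcategory]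
    (M : FMod.{w} C) : Type w := CoverIndex ((F T).obj M)

/-- The summands of the canonical morphism from a sum of objects of `T` to `M`. -/
abbrev approxObj (T : ObjectProperty (FMod.{w} C)) [EssentiallySmall.{w} T.FullSubcategory]
    (M : FMod.{w} C) (j : approxIndex T M) : T.FullSubcategory :=
  (equivSmallModel T.FullSubcategory).inverse.obj j.1

/-- The canonical morphism from a sum of objects of `T` to `M`. -/
def approx (T : ObjectProperty (FMod.{w} C)) [EssentiallySmall.{w} T.FullSubcategory]
    (M : FMod.{w} C) : (∐ fun j ↦ (approxObj T M j).obj) ⟶ M :=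
  Sigma.desc fun j ↦ ofF (repLift j.2)

lemma sigmaComparison_approx (M : FMod.{w} C) :
    sigmaComparison T (approxObj T M) ≫ (F T).map (approx T M) = cover ((F T).obj M) := by
  refine Sigma.hom_ext _ _ fun j ↦ ?_
  rw [reassoc_of% @ι_sigmaComparison, toF_comp_map, approx, Sigma.ι_desc, cover,
    Sigma.ι_desc, toF_ofF]

instance epi_F_approx (M : FMod.{w} C) : Epi ((F T).map (approx T M)) :=
  epi_of_epi_fac (sigmaComparison_approx M)

include hT

/-- A map C(-,c) → M extends to T₁ in the coresolution, the obstruction lying in Ext¹(T₂, M) = 0,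
and every map from an object of `T` to M factors through `approx`. -/
lemma epi_approx {M : FMod.{w} C} (hM : IsZero ((F' T).obj M)) : Epi (approx T M) := by
  refine epi_of_rep _ fun c b ↦ ?_
  obtain ⟨t₁, t₂, i, p, w, h₁, h₂, hS⟩ := hT.coresolution c
  obtain ⟨e, he⟩ := Ext.contravariant_sequence_exact₁ hS M (Ext.mk₀ b) (add_zero 1)
    ((isZero_F'_iff T M).1 hM _ h₂ _)
  obtain ⟨b', rfl⟩ := (Ext.mk₀_bijective _ _).2 e
  rw [Ext.mk₀_comp_mk₀] at he
  obtain ⟨a, ha⟩ := exists_lift_of_epi ((F T).map (approx T M)) (toF (t := ⟨t₁, h₁⟩) b')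
  refine ⟨i ≫ ofF a, ?_⟩
  rw [Category.assoc, ← ofF_comp_map, ha, ofF_toF]
  exact (Ext.mk₀_bijective _ _).1 he

lemma torsion_iff {M : FMod.{w} C} : torsion T M ↔ IsZero ((F' T).obj M) := by
  refine ⟨?_, fun h ↦ ⟨_, _, approx T M, fun j ↦ (approxObj T M j).property, epi_approx hT h⟩⟩
  rintro ⟨J, t, p, ht, hp⟩
  exact isZero_F'_of_epi hT p (isZero_F'_sigma (fun j ↦ ⟨t j, ht j⟩) hT)

end Approximation

lemma torsionFree_iff {M : FMod.{w} C} : torsionFree T M ↔ IsZero ((F T).obj M) := by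
  rw [isZero_F_iff]
  refine ⟨fun h t ht f ↦ h ⟨PUnit, fun _ ↦ t, Sigma.desc fun _ ↦ 𝟙 _, fun _ ↦ ht, ?_⟩ f, ?_⟩
  · have : IsSplitEpi (Sigma.desc fun _ : PUnit.{w + 1} ↦ 𝟙 t) :=
      ⟨⟨⟨Sigma.ι (fun _ : PUnit.{w + 1} ↦ t) ⟨⟩, by simp⟩⟩⟩
    infer_instance
  · rintro h N ⟨J, t, p, ht, hp⟩ f
    rw [← cancel_epi p]
    exact Sigma.hom_ext _ _ fun j ↦ by rw [h _ (ht j) (Sigma.ι t j ≫ p ≫ f)]; simp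

end Tilting

/-! ### Two forms of the five lemma. -/

section FiveLemma

variable {A : Type*} [Category* A] [Abelian A] {S S' : ShortComplex A} (φ : S ⟶ S')

lemma isIso_τ₃ (hS' : S'.Exact) [Epi S.g] [Epi S'.g] [Epi φ.τ₁] [IsIso φ.τ₂] :
    IsIso φ.τ₃ := by
  have w : S'.f ≫ inv φ.τ₂ ≫ S.g = 0 := by
    rw [← cancel_epi φ.τ₁, φ.comm₁₂_assoc, IsIso.hom_inv_id_assoc, S.zero, comp_zero]
  refine ⟨hS'.desc (inv φ.τ₂ ≫ S.g) w, ?_, ?_⟩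
  · rw [← cancel_epi S.g, ← φ.comm₂₃_assoc, hS'.g_desc, IsIso.hom_inv_id_assoc, Category.comp_id]
  · rw [← cancel_epi S'.g, hS'.g_desc_assoc, Category.assoc, ← φ.comm₂₃, IsIso.inv_hom_id_assoc,
      Category.comp_id]

lemma isIso_τ₁ (hS : S.Exact) [Mono S.f] [Mono S'.f] [Mono φ.τ₃] [IsIso φ.τ₂] :
    IsIso φ.τ₁ := by
  have w : (S'.f ≫ inv φ.τ₂) ≫ S.g = 0 := by
    rw [← cancel_mono φ.τ₃, Category.assoc, Category.assoc, ← φ.comm₂₃, IsIso.inv_hom_id_assoc,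
      S'.zero, zero_comp]
  refine ⟨hS.lift (S'.f ≫ inv φ.τ₂) w, ?_, ?_⟩
  · rw [← cancel_mono S.f, Category.assoc, hS.lift_f, φ.comm₁₂_assoc, IsIso.hom_inv_id,
      Category.comp_id, Category.id_comp]
  · rw [← cancel_mono S'.f, Category.assoc, φ.comm₁₂, hS.lift_f_assoc, Category.assoc,
      IsIso.inv_hom_id, Category.comp_id, Category.id_comp]

end FiveLemma

/-! ### The counit on torsion functors, and the vanishing of F'G, G'F and GF'. -/

section Tilting

variable {C : Type w} [SmallCategory.{w} C] [Preadditive C] {T : ObjectProperty (FMod.{w} C)}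
  [EssentiallySmall.{w} T.FullSubcategory] (hT : IsTilting T)

open Abelian

instance preservesFiniteColimits_G : PreservesFiniteColimits (G T) := by
  have : PreservesColimitsOfSize.{0, 0} (G T) := (adjunction T).leftAdjoint_preservesColimits
  exact PreservesColimitsOfSize.preservesFiniteColimits _

instance epi_G_map {M N : FMod.{w} T.FullSubcategory} (p : M ⟶ N) [Epi p] : Epi ((G T).map p) := by
  have : (G T).IsLeftAdjoint := (adjunction T).isLeftAdjoint
  infer_instance

/-- The counit of the adjunction between `G` and `F`. -/
def counitMor (M : FMod.{w} C) : (G T).obj ((F T).obj M) ⟶ M := (adjunction T).counit.app M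

/-- The unit of the adjunction between `G` and `F`. -/
def unitMor (N : FMod.{w} T.FullSubcategory) : N ⟶ (F T).obj ((G T).obj N) :=
  (adjunction T).unit.app N

lemma counitMor_naturality {M N : FMod.{w} C} (f : M ⟶ N) :
    (G T).map ((F T).map f) ≫ counitMor N = counitMor M ≫ f := (adjunction T).counit.naturality f

lemma unitMor_naturality {M N : FMod.{w} T.FullSubcategory} (f : M ⟶ N) :
    unitMor M ≫ (F T).map ((G T).map f) = f ≫ unitMor N := ((adjunction T).unit.naturality f).symm

/-- The connecting morphism `Tor₁(X₃, T) ⟶ X₁ ⊗ T` of a short exact sequence. -/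
def torδ {S : ShortComplex (FMod.{w} T.FullSubcategory)} (hS : S.ShortExact) :
    (G' T).obj S.X₃ ⟶ (G T).obj S.X₁ := leftδ (G T) hS

lemma torδ_naturality {S S' : ShortComplex (FMod.{w} T.FullSubcategory)} (hS : S.ShortExact)
    (hS' : S'.ShortExact) (φ : S ⟶ S') :
    (G' T).map φ.τ₃ ≫ torδ hS' = torδ hS ≫ (G T).map φ.τ₁ := leftδ_naturality (G T) hS hS' φ

section

variable {S : ShortComplex (FMod.{w} T.FullSubcategory)} (hS : S.ShortExact)

lemma torδ_comp : torδ hS ≫ (G T).map S.f = 0 := leftδ_comp (G T) hS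

lemma mono_torδ (h0 : IsZero ((G' T).obj S.X₂)) : Mono (torδ hS) := (leftδIsKernel (G T) hS h0).1

lemma exists_comp_torδ (h0 : IsZero ((G' T).obj S.X₂)) {W : FMod.{w} C}
    (x : W ⟶ (G T).obj S.X₁) (hx : x ≫ (G T).map S.f = 0) : ∃ y, y ≫ torδ hS = x :=
  (leftδIsKernel (G T) hS h0).2 x hx

end

lemma isIso_unit_cover (hT : IsTilting T) (N : FMod.{w} T.FullSubcategory) :
    IsIso (unitMor (∐ fun j : CoverIndex N ↦
      rep.obj ((equivSmallModel T.FullSubcategory).inverse.obj j.1))) :=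
  isIso_unit_sigma (fun j : CoverIndex N ↦ (equivSmallModel T.FullSubcategory).inverse.obj j.1) hT

lemma isIso_counit_approx (hT : IsTilting T) (M : FMod.{w} C) :
    IsIso (counitMor (T := T) (∐ fun j ↦ (approxObj T M j).obj)) :=
      isIso_counit_sigma (approxObj T M) hT

lemma shortExact_F_approx (M : FMod.{w} C) [Epi (approx T M)] :
    (ShortComplex.mk ((F T).map (kernel.ι (approx T M))) ((F T).map (approx T M))
      (F_map_comp_map T (ShortComplex.mk _ _ (kernel.condition (approx T M))))).ShortExact :=
  { exact := exact_F T (shortExact_kernel (approx T M))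
    mono_f := mono_F_map T _
    epi_g := epi_F_approx M }

include hT

lemma isZero_F'_G_cover (N : FMod.{w} T.FullSubcategory) :
    IsZero ((F' T).obj ((G T).obj (∐ fun j : CoverIndex N ↦
      rep.obj ((equivSmallModel T.FullSubcategory).inverse.obj j.1)))) := by
  let t (j : CoverIndex N) := (equivSmallModel T.FullSubcategory).inverse.obj j.1
  exact (isZero_F'_sigma t hT).of_iso ((F' T).mapIso (asIso (sigmaComparison' t)))

lemma isZero_F'_G (N : FMod.{w} T.FullSubcategory) : IsZero ((F' T).obj ((G T).obj N)) :=
  isZero_F'_of_epi hT ((G T).map (cover N)) (isZero_F'_G_cover hT N)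

/-- Maps from `T` to M lift along `approx`, so the connecting map is zero and F' of the kernel
embeds in F' of the sum, which is zero. -/
lemma isZero_F'_kernel_approx (M : FMod.{w} C) [Epi (approx T M)] :
    IsZero ((F' T).obj (kernel (approx T M))) := by
  have hS := shortExact_kernel (approx T M)
  have h0 : homδ T hS = 0 := by
    have : Epi ((F T).map (ShortComplex.mk _ _ (kernel.condition (approx T M))).g) :=
      epi_F_approx M
    rw [← cancel_epi ((F T).map (ShortComplex.mk _ _ (kernel.condition (approx T M))).g),
      map_comp_homδ, comp_zero]
  have : Mono ((F' T).map (kernel.ι (approx T M))) := (exact_homδ_F' T hS).mono_g h0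
  exact IsZero.of_mono ((F' T).map (kernel.ι (approx T M))) (isZero_F'_sigma _ hT)

lemma epi_counit {M : FMod.{w} C} (hM : IsZero ((F' T).obj M)) : Epi (counitMor (T := T) M) := by
  have := epi_approx hT hM
  have := isIso_counit_approx hT M
  have : Epi (counitMor (T := T) _ ≫ approx T M) := epi_comp _ _
  exact epi_of_epi_fac (counitMor_naturality (approx T M))

/-- The counit is an isomorphism on the approximating sum and epi on the kernel of `approx`, which
is torsion again. This suffices for the five lemma. -/
lemma isIso_counit {M : FMod.{w} C} (hM : IsZero ((F' T).obj M)) :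
    IsIso (counitMor (T := T) M) := by
  have := epi_approx hT hM
  have h1 := epi_counit hT (isZero_F'_kernel_approx hT M)
  have h2 := isIso_counit_approx hT M
  let S := ShortComplex.mk ((G T).map ((F T).map (kernel.ι (approx T M))))
    ((G T).map ((F T).map (approx T M))) (by
      rw [← Functor.map_comp, ← Functor.map_comp, kernel.condition, Functor.map_zero,
        Functor.map_zero])
  let S' := ShortComplex.mk (kernel.ι (approx T M)) (approx T M) (kernel.condition _)
  let φ : S ⟶ S' :=
    { τ₁ := counitMor (kernel (approx T M))
      τ₂ := counitMor _
      τ₃ := counitMor M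
      comm₁₂ := (counitMor_naturality (kernel.ι (approx T M))).symm
      comm₂₃ := (counitMor_naturality (approx T M)).symm }
  have : Epi S.g := epi_G_map ((F T).map (approx T M))
  have : Epi S'.g := inferInstanceAs (Epi (approx T M))
  have : Epi φ.τ₁ := h1
  have : IsIso φ.τ₂ := h2
  exact isIso_τ₃ φ (shortExact_kernel (approx T M)).exact

omit hT in
lemma isZero_of_mono_zero {A : Type*} [Category* A] [Preadditive A] {X Y : A} {f : X ⟶ Y} [Mono f]
    (h : f = 0) : IsZero X := by
  rw [IsZero.iff_id_eq_zero, ← cancel_mono f, h, comp_zero, comp_zero]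

omit hT in
lemma isZero_of_epi_zero {A : Type*} [Category* A] [Preadditive A] {X Y : A} {f : X ⟶ Y} [Epi f]
    (h : f = 0) : IsZero Y := by
  rw [IsZero.iff_id_eq_zero, ← cancel_epi f, h, zero_comp, zero_comp]

omit hT in
lemma isZero_G'_of_mono {S : ShortComplex (FMod.{w} T.FullSubcategory)} (hS : S.ShortExact)
    (h0 : IsZero ((G' T).obj S.X₂)) [Mono ((G T).map S.f)] : IsZero ((G' T).obj S.X₃) := by
  have := mono_torδ hS h0
  exact isZero_of_mono_zero (f := torδ hS)
    (by rw [← cancel_mono ((G T).map S.f), torδ_comp, zero_comp])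

omit hT in
lemma mono_of_isZero_G' {S : ShortComplex (FMod.{w} T.FullSubcategory)} (hS : S.ShortExact)
    (h0 : IsZero ((G' T).obj S.X₂)) (h : IsZero ((G' T).obj S.X₃)) : Mono ((G T).map S.f) := by
  refine Preadditive.mono_of_cancel_zero _ fun {W} x hx ↦ ?_
  obtain ⟨y, rfl⟩ := exists_comp_torδ hS h0 x hx
  rw [h.eq_zero_of_tgt y, zero_comp]

omit hT in
lemma isZero_G'_projective (N : FMod.{w} T.FullSubcategory) [Projective N] :
    IsZero ((G' T).obj N) :=
  (G T).isZero_leftDerived_obj_projective_succ 0 N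

/-- F of the approximating sequence has a projective middle term, and the counits identify G of its
first map with the inclusion of the kernel of `approx`, which is mono. -/
lemma isZero_G'_F_of_torsion {M : FMod.{w} C} (hM : IsZero ((F' T).obj M)) :
    IsZero ((G' T).obj ((F T).obj M)) := by
  have := epi_approx hT hM
  have h1 := isIso_counit hT (isZero_F'_kernel_approx hT M)
  have h2 := isIso_counit_approx hT M
  have := projective_F_sigma (approxObj T M) hT
  have : Mono (counitMor (T := T) _ ≫ kernel.ι (approx T M)) := mono_comp _ _
  have : Mono ((G T).map ((F T).map (kernel.ι (approx T M)))) :=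
    mono_of_mono_fac (counitMor_naturality (kernel.ι (approx T M)))
  exact isZero_G'_of_mono (shortExact_F_approx M) (isZero_G'_projective _)

/-- F sees only the image of `approx`, the largest torsion subfunctor of M, so the torsion case
applies. -/
lemma isZero_G'_F (M : FMod.{w} C) : IsZero ((G' T).obj ((F T).obj M)) := by
  let i := Limits.image.ι (approx T M)
  have h1 : IsZero ((F' T).obj (Limits.image (approx T M))) :=
    isZero_F'_of_epi hT (Limits.factorThruImage (approx T M)) (isZero_F'_sigma _ hT)
  have : Epi ((F T).map i) := by
    have h : (F T).map (Limits.factorThruImage (approx T M)) ≫ (F T).map i =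
        (F T).map (approx T M) := by
      rw [← Functor.map_comp, Limits.image.fac]
    exact epi_of_epi_fac h
  have : Mono ((F T).map i) := mono_F_map T i
  have : IsIso ((F T).map i) := isIso_of_mono_of_epi _
  exact (isZero_G'_F_of_torsion hT h1).of_iso ((G' T).mapIso (asIso ((F T).map i)).symm)

/-- Embed M in an injective I, so that F'(M) is the cokernel of F(I) → F(I/M). Both I and I/M are
torsion, so G of this map is I → I/M up to the counits, hence epi; thus G(F(I/M)) → G(F'(M)) is both
epi and zero. -/
lemma isZero_G_F' (M : FMod.{w} C) : IsZero ((G T).obj ((F' T).obj M)) := by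
  let i := Injective.ι M
  let q := cokernel.π i
  have hS := shortExact_cokernel i
  have hI := isZero_F'_of_injective T (Injective.under M)
  have hJ := isZero_F'_of_epi hT q hI
  have : Epi (homδ T hS) := (exact_homδ_F' T hS).epi_f (hI.eq_of_tgt _ _)
  have h1 := isIso_counit hT hI
  have h2 := isIso_counit hT hJ
  have : Epi ((G T).map ((F T).map q)) := by
    have e : Epi (counitMor (T := T) (Injective.under M) ≫ q) := epi_comp _ _
    have h : (G T).map ((F T).map q) = (counitMor (Injective.under M) ≫ q) ≫ inv (counitMor _) := by
      rw [← counitMor_naturality q, Category.assoc, IsIso.hom_inv_id, Category.comp_id]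
    rw [h]
    exact epi_comp _ _
  have h0 : (G T).map (homδ T hS) = 0 := by
    rw [← cancel_epi ((G T).map ((F T).map q)), comp_zero, ← Functor.map_comp]
    exact (congrArg (G T).map (map_comp_homδ T hS)).trans (Functor.map_zero _ _ _)
  exact isZero_of_epi_zero h0

end Tilting

/-! ### The unit on `classY`, and the vanishing of FG'. -/

section Tilting

variable {C : Type w} [SmallCategory.{w} C] [Preadditive C] {T : ObjectProperty (FMod.{w} C)}
  [EssentiallySmall.{w} T.FullSubcategory]

open Abelian

section Coresolution

variable {c : C} {t₁ t₂ : T.FullSubcategory} {i : rep.obj c ⟶ t₁.obj} {p : t₁ ⟶ t₂}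
  {w : i ≫ p.hom = 0} (hS : (ShortComplex.mk i p.hom w).ShortExact)
  {N : FMod.{w} T.FullSubcategory}

include hS

lemma exists_extension_of_isZero_F' {M : FMod.{w} C} (hM : IsZero ((F' T).obj M))
    (b : rep.obj c ⟶ M) : ∃ b' : t₁.obj ⟶ M, i ≫ b' = b := by
  obtain ⟨e, he⟩ := Ext.contravariant_sequence_exact₁ hS M (Ext.mk₀ b) (add_zero 1)
    ((isZero_F'_iff T M).1 hM _ t₂.property _)
  obtain ⟨b', rfl⟩ := (Ext.mk₀_bijective _ _).2 e
  rw [Ext.mk₀_comp_mk₀] at he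
  exact ⟨b', (Ext.mk₀_bijective _ _).1 he⟩

/-- This and the next two lemmas say that 0 → N(t₂) → N(t₁) → G(N)(c) → 0 is exact when the unit at
N is an isomorphism: the coresolution of `c` computes G(N) at `c`. -/
lemma exists_comp_unitMor_of_isIso [IsIso (unitMor N)] (hN : IsZero ((F' T).obj ((G T).obj N)))
    (b : rep.obj c ⟶ (G T).obj N) : ∃ n : rep.obj t₁ ⟶ N, i ≫ ofF (n ≫ unitMor N) = b := by
  obtain ⟨b', hb'⟩ := exists_extension_of_isZero_F' hS hN b
  exact ⟨toF b' ≫ inv (unitMor N), by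
    rw [Category.assoc, IsIso.inv_hom_id, Category.comp_id, ofF_toF, hb']⟩

lemma exists_map_comp_of_comp_eq_zero [IsIso (unitMor N)] (n : rep.obj t₁ ⟶ N)
    (hn : i ≫ ofF (n ≫ unitMor N) = 0) : ∃ m : rep.obj t₂ ⟶ N, rep.map p ≫ m = n := by
  have := hS.epi_g
  obtain ⟨b, hb⟩ : ∃ b : t₂.obj ⟶ (G T).obj N, p.hom ≫ b = ofF (n ≫ unitMor N) :=
    ⟨hS.exact.desc _ hn, hS.exact.g_desc _ _⟩
  refine ⟨toF b ≫ inv (unitMor N), ?_⟩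
  rw [← Category.assoc, map_comp_toF, hb, toF_ofF, Category.assoc, IsIso.hom_inv_id,
    Category.comp_id]

lemma eq_zero_of_map_comp_eq_zero [IsIso (unitMor N)] (m : rep.obj t₂ ⟶ N)
    (hm : rep.map p ≫ m = 0) : m = 0 := by
  have : Epi p.hom := hS.epi_g
  rw [← cancel_mono (unitMor N), zero_comp]
  refine ofF_eq_zero ?_
  rw [← cancel_epi p.hom, ← ofF_map_comp, reassoc_of% hm, zero_comp, ofF_zero, comp_zero]

lemma exists_comp_unitMor (hT : IsTilting T) (b : rep.obj c ⟶ (G T).obj N) :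
    ∃ n : rep.obj t₁ ⟶ N, i ≫ ofF (n ≫ unitMor N) = b := by
  have := isIso_unit_cover hT N
  obtain ⟨b', hb'⟩ := exists_lift_of_epi ((G T).map (cover N)) b
  obtain ⟨n, hn⟩ := exists_comp_unitMor_of_isIso hS (isZero_F'_G_cover hT N) b'
  exact ⟨n ≫ cover N, by
    rw [Category.assoc, ← unitMor_naturality, ← Category.assoc, ofF_comp_map, ← Category.assoc, hn,
      hb']⟩

end Coresolution

variable (hT : IsTilting T)
include hT

/-- An element of G(ker)(c) is represented by `n` in ker(t₁). If it dies in G of the cover, `n`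
comes from some `m` over t₂ in the cover; the point is that `m` already lies in the kernel, which
makes the element zero. -/
lemma mono_G_kernel_cover {L P : FMod.{w} T.FullSubcategory} (j : L ⟶ P) [Mono j]
    [IsIso (unitMor P)] : Mono ((G T).map (kernel.ι (cover L))) := by
  refine mono_of_rep _ fun c b hb ↦ ?_
  obtain ⟨t₁, t₂, i, p, w, h₁, h₂, hS⟩ := hT.coresolution c
  obtain ⟨t₁, rfl⟩ : ∃ t : T.FullSubcategory, t.obj = t₁ := ⟨⟨t₁, h₁⟩, rfl⟩
  obtain ⟨t₂, rfl⟩ : ∃ t : T.FullSubcategory, t.obj = t₂ := ⟨⟨t₂, h₂⟩, rfl⟩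
  obtain ⟨p, rfl⟩ : ∃ q : t₁ ⟶ t₂, q.hom = p := ⟨ObjectProperty.homMk p, rfl⟩
  have := isIso_unit_cover hT L
  obtain ⟨n, rfl⟩ := exists_comp_unitMor hS hT b
  obtain ⟨m, hm⟩ := exists_map_comp_of_comp_eq_zero hS (n ≫ kernel.ι (cover L)) (by
    rw [Category.assoc, ← unitMor_naturality, ← Category.assoc, ofF_comp_map, ← Category.assoc, hb])
  -- The embedding in `P` enters here: restriction P(t₂) → P(t₁) is injective because the unit at
  -- `P` is an isomorphism.
  have h0 : m ≫ cover L ≫ j = 0 := eq_zero_of_map_comp_eq_zero hS _ (by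
    rw [reassoc_of% hm, kernel.condition_assoc, zero_comp, comp_zero])
  have h1 : m ≫ cover L = 0 := by rw [← cancel_mono j, Category.assoc, h0, zero_comp]
  have h2 : n = rep.map p ≫ kernel.lift _ m h1 := by
    rw [← cancel_mono (kernel.ι (cover L)), Category.assoc, kernel.lift_ι, hm]
  rw [h2, Category.assoc, ofF_map_comp, reassoc_of% w, zero_comp]

omit hT in
lemma shortExact_G {S : ShortComplex (FMod.{w} T.FullSubcategory)} (hS : S.ShortExact)
    [Mono ((G T).map S.f)] : (ShortComplex.mk ((G T).map S.f) ((G T).map S.g) (by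
      rw [← Functor.map_comp, S.zero, Functor.map_zero])).ShortExact :=
  have := hS.epi_g
  { exact := exact_map_of_epi (G T) hS.exact
    mono_f := inferInstance
    epi_g := epi_G_map S.g }

lemma epi_F_G {S : ShortComplex (FMod.{w} T.FullSubcategory)} (hS : S.ShortExact)
    [Mono ((G T).map S.f)] : Epi ((F T).map ((G T).map S.g)) :=
  (exact_F_homδ T (shortExact_G hS)).epi_f ((isZero_F'_G hT S.X₁).eq_of_tgt _ _)

lemma epi_unit {S : ShortComplex (FMod.{w} T.FullSubcategory)} (hS : S.ShortExact)
    [Mono ((G T).map S.f)] [IsIso (unitMor S.X₂)] : Epi (unitMor S.X₃) := by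
  have := epi_F_G hT hS
  have : Epi (unitMor _ ≫ (F T).map ((G T).map S.g)) := epi_comp _ _
  exact epi_of_epi_fac (unitMor_naturality S.g).symm

lemma isIso_unit_of_shortExact {S : ShortComplex (FMod.{w} T.FullSubcategory)} (hS : S.ShortExact)
    [Mono ((G T).map S.f)] [IsIso (unitMor S.X₁)] [IsIso (unitMor S.X₂)] :
    IsIso (unitMor S.X₃) := by
  have := hS.epi_g
  let S' := ShortComplex.mk ((F T).map ((G T).map S.f)) ((F T).map ((G T).map S.g)) (by
    rw [← Functor.map_comp, ← Functor.map_comp, S.zero, Functor.map_zero, Functor.map_zero])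
  let φ : S ⟶ S' :=
    { τ₁ := unitMor S.X₁
      τ₂ := unitMor S.X₂
      τ₃ := unitMor S.X₃
      comm₁₂ := unitMor_naturality S.f
      comm₂₃ := unitMor_naturality S.g }
  have : Epi S'.g := epi_F_G hT hS
  have : Epi φ.τ₁ := inferInstanceAs (Epi (unitMor S.X₁))
  have : IsIso φ.τ₂ := inferInstanceAs (IsIso (unitMor S.X₂))
  exact isIso_τ₃ φ (exact_F T (shortExact_G hS))

/-- The unit is epi by comparison with the cover of L, where `mono_G_kernel_cover` supplies left
exactness, and mono because followed by FG(j) it is the mono `j ≫ unitMor P`. -/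
lemma isIso_unit_of_mono {L P : FMod.{w} T.FullSubcategory} (j : L ⟶ P) [Mono j]
    [IsIso (unitMor P)] : IsIso (unitMor L) := by
  have := isIso_unit_cover hT L
  have := mono_G_kernel_cover hT j
  have := epi_unit hT (shortExact_kernel (cover L))
  have : Mono (j ≫ unitMor P) := mono_comp _ _
  have : Mono (unitMor L) := mono_of_mono_fac (unitMor_naturality j)
  exact isIso_of_mono_of_epi _

lemma isIso_unit_kernel_cover (N : FMod.{w} T.FullSubcategory) :
    IsIso (unitMor (kernel (cover N))) :=
  have := isIso_unit_cover hT N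
  isIso_unit_of_mono hT (kernel.ι (cover N))

omit hT in
lemma projective_cover (N : FMod.{w} T.FullSubcategory) :
    Projective (∐ fun j : CoverIndex N ↦
      rep.obj ((equivSmallModel T.FullSubcategory).inverse.obj j.1)) :=
  projective_sigma_rep fun j : CoverIndex N ↦
    (equivSmallModel T.FullSubcategory).inverse.obj j.1

lemma isIso_unit {N : FMod.{w} T.FullSubcategory} (hN : IsZero ((G' T).obj N)) :
    IsIso (unitMor N) := by
  have := isIso_unit_cover hT N
  have := isIso_unit_kernel_cover hT N
  have := projective_cover N
  have hm : Mono ((G T).map (kernel.ι (cover N))) :=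
    mono_of_isZero_G' (shortExact_kernel (cover N)) (isZero_G'_projective _) hN
  exact isIso_unit_of_shortExact hT (shortExact_kernel (cover N))

/-- With K the kernel of the cover P → N, G'(N) is the kernel of G(K) → G(P). The units turn F of
that map into the mono K → P, so F(G'(N)), which embeds in its kernel, vanishes. -/
lemma isZero_F_G' (N : FMod.{w} T.FullSubcategory) : IsZero ((F T).obj ((G' T).obj N)) := by
  have := isIso_unit_cover hT N
  have := isIso_unit_kernel_cover hT N
  have := projective_cover N
  have hS := shortExact_kernel (cover N)
  have hm := mono_torδ hS (isZero_G'_projective _)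
  refine isZero_of_rep fun t b ↦ ?_
  rw [← cancel_mono ((F T).map (torδ hS)), zero_comp]
  have h1 : (b ≫ (F T).map (torδ hS)) ≫ inv (unitMor (kernel (cover N))) = 0 := by
    rw [← cancel_mono (kernel.ι (cover N)), ← cancel_mono (unitMor _), Category.assoc,
      Category.assoc, ← unitMor_naturality, IsIso.inv_hom_id_assoc, Category.assoc,
      ← Functor.map_comp]
    have := torδ_comp hS
    rw [this, Functor.map_zero, comp_zero, zero_comp, zero_comp]
  rw [← cancel_mono (inv (unitMor (kernel (cover N)))), h1, zero_comp]

end Tilting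

/-! ### Preservation of finite presentation. -/

section Coherence

variable {C : Type w} [SmallCategory.{w} C] [Preadditive C] {T : ObjectProperty (FMod.{w} C)}

lemma IsCoh.of_iso {X : Type u} [Category.{w} X] [Preadditive X] {M N : FMod.{w} X} (h : IsCoh M)
    (e : M ≅ N) : IsCoh N := h.of_mono (h.1.of_epi e.hom) e.inv

/-- The image of `d` is the kernel of `f`, a map between coherent functors. This cuts a long exact
sequence at a coherent term. -/
lemma exists_factor_coh {X : Type u} [Category.{w} X] [Preadditive X] [HasBinaryBiproducts X]
    [EssentiallySmall.{w} X]
    {A B D E : FMod.{w} X} {a : A ⟶ B} {d : B ⟶ D} {f : D ⟶ E} {w : a ≫ d = 0} {w' : d ≫ f = 0}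
    (h : (ShortComplex.mk a d w).Exact) (h' : (ShortComplex.mk d f w').Exact) (hD : IsCoh D)
    (hE : IsCoh E) : ∃ (Z : FMod.{w} X) (e : B ⟶ Z) (w : a ≫ e = 0), IsCoh Z ∧
      (ShortComplex.mk a e w).Exact ∧ Epi e := by
  have he : kernel.lift f d w' ≫ kernel.ι f = d := kernel.lift_ι _ _ _
  have hz : a ≫ kernel.lift f d w' = 0 := by
    rw [← cancel_mono (kernel.ι f), Category.assoc, he, zero_comp, w]
  refine ⟨kernel f, kernel.lift f d w', hz, IsCoh.kernel (ShortComplex.exact_of_f_is_kernel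
    (ShortComplex.mk _ _ (kernel.condition f)) (kernelIsKernel f)) hD hE,
    exact_of_rep fun t b hb ↦ ?_, h'.epi_kernelLift⟩
  refine exists_lift_of_exact h b ?_
  exact (congrArg (b ≫ ·) he.symm).trans 
    ((Category.assoc _ _ _).symm.trans ((congrArg (· ≫ kernel.ι f) hb).trans zero_comp))

variable [EssentiallySmall.{w} T.FullSubcategory]

/-- `T( , t) ⊗ T` is `t`. -/
def GRepIso (t : T.FullSubcategory) : (G T).obj (rep.obj t) ≅ t.obj where
  hom := ((adjunction T).homEquiv _ _).symm (toF (𝟙 t.obj))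
  inv := ofF (unitMor (rep.obj t))
  hom_inv_id := by
    apply ((adjunction T).homEquiv _ _).injective
    rw [Adjunction.homEquiv_naturality_right, Equiv.apply_symm_apply, toF_comp_map,
      Category.id_comp, toF_ofF, Adjunction.homEquiv_id]
    rfl
  inv_hom_id := by
    rw [← ofF_comp_map]
    refine (congrArg ofF (((adjunction T).homEquiv_unit _ _ _).symm.trans
      (Equiv.apply_symm_apply _ _))).trans (ofF_toF _)

/-- `Hom( , t)` is the representable functor `T( , t)`. -/
lemma isIso_toF_id (t : T.FullSubcategory) : IsIso (toF (𝟙 t.obj)) := by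
  have : Mono (toF (𝟙 t.obj)) := by
    refine mono_of_rep _ fun s b hb ↦ ?_
    obtain ⟨u, rfl⟩ : ∃ u : s ⟶ t, rep.map u = b := ⟨_, rep_map_repElt _⟩
    rw [map_comp_toF, Category.comp_id] at hb
    have h3 : u.hom = 0 := by rw [← ofF_toF u.hom, hb, ofF_zero]
    have h4 : u = 0 := by ext1; exact h3
    rw [h4, Functor.map_zero]
  have : Epi (toF (𝟙 t.obj)) := by
    refine epi_of_rep _ fun s b ↦ ⟨rep.map (ObjectProperty.homMk (ofF b)), ?_⟩
    rw [map_comp_toF, Category.comp_id]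
    exact toF_ofF b
  exact isIso_of_mono_of_epi _

variable (hT : IsTilting T) (hC : HasPseudokernels C) (hT' : HasPseudokernels T.FullSubcategory)

section

include hC hT

lemma isCoh_G [HasBinaryBiproducts C] {N : FMod.{w} T.FullSubcategory}
    (hN : finPres T.FullSubcategory N) : IsCoh ((G T).obj N) := by
  obtain ⟨t₁, t₀, f, p, w, ex, hp⟩ := hN
  have h (t : T.FullSubcategory) : IsCoh ((G T).obj (rep.obj t)) :=
    (isCoh_of_finPres hC (hT.finPres _ t.property)).of_iso (GRepIso t).symm
  have := epi_G_map (T := T) p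
  exact IsCoh.cokernel (exact_map_of_epi (G T) ex) (h t₁).1 (h t₀).1
    (weakPullbacks (h t₀).2)

-- With K the kernel of T(-,t) → N, the projectivity of T(-,t) makes G'(N) the kernel of G(K) →
-- G(T(-,t)), a map between coherent functors.
include hT' in
lemma isCoh_G' [HasBinaryBiproducts C] {N : FMod.{w} T.FullSubcategory}
    (hN : IsCoh N) : IsCoh ((G' T).obj N) := by
  obtain ⟨t, p, hp⟩ := hN.1
  have hS := shortExact_kernel p
  have hK : IsCoh (kernel p) := IsCoh.kernel hS.exact (isCoh_rep hT' t) hN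
  have h0 := isZero_G'_projective (rep.obj t)
  have := mono_torδ hS h0
  refine IsCoh.kernel (S := ShortComplex.mk _ _ (torδ_comp hS)) ?_ (isCoh_G hT hC hK.finPres)
    (isCoh_G hT hC (isCoh_rep hT' t).finPres)
  exact exact_of_rep fun c b hb ↦ exists_comp_torδ hS h0 b hb

end

include hT hT'

omit hT in
lemma isCoh_F_obj (t : T.FullSubcategory) : IsCoh ((F T).obj t.obj) :=
  have := isIso_toF_id t
  (isCoh_rep hT' t).of_iso (asIso (toF (𝟙 t.obj)))

/-- F of the coresolution presents this as a kernel of a map between representables of `T`; its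
cokernel is F' of the same functor, which gives `isCoh_F'_rep`. -/
lemma isCoh_F_rep (c : C) : IsCoh ((F T).obj (rep.obj c)) := by
  obtain ⟨t₁, t₂, i, p, w, h₁, h₂, hS⟩ := hT.coresolution c
  have : Mono i := hS.mono_f
  have := mono_F_map T i
  exact IsCoh.kernel (exact_F T hS) (isCoh_F_obj hT' ⟨t₁, h₁⟩) (isCoh_F_obj hT' ⟨t₂, h₂⟩)

variable [HasBinaryBiproducts T.FullSubcategory]

lemma isCoh_F'_rep (c : C) : IsCoh ((F' T).obj (rep.obj c)) := by
  obtain ⟨t₁, t₂, i, p, w, h₁, h₂, hS⟩ := hT.coresolution c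
  have hz : IsZero ((F' T).obj t₁) :=
    (isZero_F'_iff T t₁).2 fun s hs e ↦ (hT.ext_one_eq_zero s t₁ hs h₁).elim _ _
  have : Epi (homδ T hS) := (exact_homδ_F' T hS).epi_f (hz.eq_of_tgt _ _)
  exact IsCoh.cokernel (exact_F_homδ T hS) (isCoh_F_obj hT' ⟨t₁, h₁⟩).1
    (isCoh_F_obj hT' ⟨t₂, h₂⟩).1 (weakPullbacks (isCoh_F_obj hT' ⟨t₂, h₂⟩).2)

lemma isCoh_F' {M : FMod.{w} C} (hM : finPres C M) : IsCoh ((F' T).obj M) := by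
  obtain ⟨x₁, x₀, f, p, w, ex, hp⟩ := hM
  have hS := shortExact_kernel p
  have : Epi (kernel.lift p f w) := ex.epi_kernelLift
  have := epi_F' (shortExact_kernel (kernel.lift p f w)) hT
  have hK : IsFG ((F' T).obj (kernel p)) :=
    (isCoh_F'_rep hT hT' x₁).1.of_epi ((F' T).map (kernel.lift p f w))
  have := epi_F' hS hT
  exact IsCoh.cokernel (exact_F' T hS) hK (isCoh_F'_rep hT hT' x₀).1
    (weakPullbacks (isCoh_F'_rep hT hT' x₀).2)

include hC

/-- The sequence is F(K) → F(C(-,x)) → F(M) → Z → 0, with Z the kernel of F'(K) → F'(C(-,x)). -/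
lemma exists_exact_F {M : FMod.{w} C} (hM : IsCoh M) :
    ∃ (x : C) (K : FMod.{w} C) (Z : FMod.{w} T.FullSubcategory) (i : K ⟶ rep.obj x)
      (p : rep.obj x ⟶ M) (e : (F T).obj M ⟶ Z) (w : (F T).map i ≫ (F T).map p = 0)
      (w' : (F T).map p ≫ e = 0), IsCoh K ∧ IsCoh Z ∧ (ShortComplex.mk _ _ w).Exact ∧
        (ShortComplex.mk _ _ w').Exact ∧ Epi e := by
  obtain ⟨x, p, hp⟩ := hM.1
  have hS := shortExact_kernel p
  have hK : IsCoh (kernel p) := IsCoh.kernel hS.exact (isCoh_rep hC x) hM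
  obtain ⟨Z, e, w', hZ, ex, he⟩ := exists_factor_coh (exact_F_homδ T hS) (exact_homδ_F' T hS)
    (isCoh_F' hT hT' hK.finPres) (isCoh_F'_rep hT hT' x)
  have ex' := exact_F T hS
  exact ⟨x, kernel p, Z, kernel.ι p, p, e, _, w', hK, hZ, ex', ex, he⟩

lemma isFG_F {M : FMod.{w} C} (hM : IsCoh M) : IsFG ((F T).obj M) := by
  obtain ⟨x, K, Z, i, p, e, w, w', hK, hZ, ex, ex', he⟩ := exists_exact_F hT hC hT' hM
  exact isFG_of_exact ex' (isCoh_F_rep hT hT' x).1 hZ.1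

lemma isCoh_F {M : FMod.{w} C} (hM : IsCoh M) : IsCoh ((F T).obj M) := by
  obtain ⟨x, K, Z, i, p, e, w, w', hK, hZ, ex, ex', he⟩ := exists_exact_F hT hC hT' hM
  refine IsCoh.extension (shortExact_kernel e) ?_ hZ
  have hp : Epi (kernel.lift e ((F T).map p) w') := ex'.epi_kernelLift
  have h0 : (F T).map i ≫ kernel.lift e ((F T).map p) w' = 0 := by
    rw [← cancel_mono (kernel.ι e), Category.assoc, kernel.lift_ι, w, zero_comp]
  refine IsCoh.cokernel (S := ShortComplex.mk _ _ h0) (exact_of_rep fun t b hb ↦ ?_)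
    -- Finite generation of F is applied to `K`, again coherent; it makes the image of F(C(-,x)) in
    -- F(M) coherent.
    (isFG_F hT hC hT' hK) (isCoh_F_rep hT hT' x).1 (weakPullbacks (isCoh_F_rep hT hT' x).2)
  refine exists_lift_of_exact ex b ?_
  exact (congrArg (b ≫ ·) (kernel.lift_ι e ((F T).map p) w').symm).trans
    ((Category.assoc _ _ _).symm.trans ((congrArg (· ≫ kernel.ι e) hb).trans zero_comp))

end Coherence

/-- `Equivalence.mk` adjusts only the unit and keeps both functors, so the required equalities of
functors hold by `rfl`. -/
lemma induceEquivalence_of_isos {A B : Type*} [Category* A] [Category* B] {U : A ⥤ B} {V : B ⥤ A}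
    {P : ObjectProperty A} {Q : ObjectProperty B} (hU : ∀ M, P M → Q (U.obj M))
    (hV : ∀ N, Q N → P (V.obj N)) (a : ∀ M, P M → (V.obj (U.obj M) ≅ M))
    (ha : ∀ {M M'} (hM : P M) (hM' : P M') (f : M ⟶ M'),
      V.map (U.map f) ≫ (a M' hM').hom = (a M hM).hom ≫ f)
    (b : ∀ N, Q N → (N ≅ U.obj (V.obj N)))
    (hb : ∀ {N N'} (hN : Q N) (hN' : Q N') (f : N ⟶ N'),
      f ≫ (b N' hN').hom = (b N hN).hom ≫ U.map (V.map f)) :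
    InduceEquivalence U V P Q :=
  ⟨hU, hV, CategoryTheory.Equivalence.mk (Q.lift (P.ι ⋙ U) (fun M ↦ hU _ M.property))
    (P.lift (Q.ι ⋙ V) (fun N ↦ hV _ N.property))
    (NatIso.ofComponents (fun M ↦ P.isoMk (a M.obj M.property)) fun {M M'} f ↦ by
      ext1
      exact ha M.property M'.property f.hom).symm
    (NatIso.ofComponents (fun N ↦ Q.isoMk (b N.obj N.property)) fun {N N'} f ↦ by
      ext1
      exact hb N.property N'.property f.hom).symm, rfl, rfl⟩

/-! ### The two equivalences. -/

section Tilting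

variable {C : Type w} [SmallCategory.{w} C] [Preadditive C] {T : ObjectProperty (FMod.{w} C)}
  [EssentiallySmall.{w} T.FullSubcategory] (hT : IsTilting T)

include hT

lemma torsion_G (N : FMod.{w} T.FullSubcategory) : torsion T ((G T).obj N) :=
  (torsion_iff hT).2 (isZero_F'_G hT N)

lemma induceEquivalence_F_G {P : ObjectProperty (FMod.{w} C)}
    {Q : ObjectProperty (FMod.{w} T.FullSubcategory)} (hF : ∀ M, P M → Q ((F T).obj M))
    (hG : ∀ N, Q N → P ((G T).obj N)) :
    InduceEquivalence (F T) (G T) (torsion T ⊓ P) (classY T ⊓ Q) :=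
  induceEquivalence_of_isos
    (fun M hM ↦ ⟨isZero_G'_F hT M, hF M hM.2⟩)
    (fun N hN ↦ ⟨torsion_G hT N, hG N hN.2⟩)
    (fun M hM ↦ have := isIso_counit hT ((torsion_iff hT).1 hM.1); asIso (counitMor M))
    (fun _ _ f ↦ counitMor_naturality f)
    (fun N hN ↦ have := isIso_unit hT hN.1; asIso (unitMor N))
    (fun _ _ f ↦ (unitMor_naturality f).symm)

section TorsionFree

variable (M : FMod.{w} C)

omit hT in
variable (T) in
lemma shortExact_homδ (hM : IsZero ((F T).obj M)) :
    (ShortComplex.mk _ _ (map_comp_homδ T (shortExact_cokernel (Injective.ι M)))).ShortExact where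
  exact := exact_F_homδ T _
  mono_f := (exact_F T (shortExact_cokernel (Injective.ι M))).mono_g (hM.eq_of_src _ _)
  epi_g := (exact_homδ_F' T (shortExact_cokernel (Injective.ι M))).epi_f
    ((isZero_F'_of_injective T (Injective.under M)).eq_of_tgt _ _)

/-- Since G'F = 0, G'F'(M) is the kernel of GF(I) → GF(I/M), which the counits identify with I →
I/M. The composite with the embedding in I is recorded because it determines the isomorphism. -/
lemma exists_iso_G'_F' (hM : IsZero ((F T).obj M)) :
    ∃ a : (G' T).obj ((F' T).obj M) ≅ M,
      a.hom ≫ Injective.ι M = torδ (shortExact_homδ T M hM) ≫ counitMor (Injective.under M) := by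
  let i := Injective.ι M
  let q := cokernel.π i
  have hS := shortExact_cokernel i
  have hR := shortExact_homδ T M hM
  have hI := isZero_F'_of_injective T (Injective.under M)
  have := isIso_counit hT hI
  have := isIso_counit hT (isZero_F'_of_epi hT q hI)
  have h0 : IsZero ((G' T).obj ((F T).obj (cokernel i))) := isZero_G'_F hT _
  have hm := mono_torδ hR h0
  let S := ShortComplex.mk _ _ (torδ_comp hR)
  have exS : S.Exact := exact_of_rep fun c b hb ↦ exists_comp_torδ hR h0 b hb
  let S' := ShortComplex.mk i q (cokernel.condition i)
  have hmi : Mono S'.f := inferInstanceAs (Mono i)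
  have w : (torδ hR ≫ counitMor (Injective.under M)) ≫ q = 0 := by
    rw [Category.assoc, ← counitMor_naturality q]
    exact (reassoc_of% torδ_comp hR) _ |>.trans zero_comp
  let φ : S ⟶ S' :=
    { τ₁ := hS.exact.lift (torδ hR ≫ counitMor (Injective.under M)) w
      τ₂ := counitMor (Injective.under M)
      τ₃ := counitMor (cokernel i)
      comm₁₂ := hS.exact.lift_f _ _
      comm₂₃ := (counitMor_naturality q).symm }
  have : Mono S.f := hm
  have : Mono φ.τ₃ := inferInstanceAs (Mono (counitMor (cokernel i)))
  have : IsIso φ.τ₂ := inferInstanceAs (IsIso (counitMor (Injective.under M)))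
  have := isIso_τ₁ φ exS
  exact ⟨asIso φ.τ₁, φ.comm₁₂⟩

/-- For a torsion free `M`, the natural isomorphism from `Tor₁(Ext¹( , M), T)` to `M`. -/
def isoG'F' (hM : IsZero ((F T).obj M)) : (G' T).obj ((F' T).obj M) ≅ M :=
  (exists_iso_G'_F' hT M hM).choose

lemma isoG'F'_hom_comp (hM : IsZero ((F T).obj M)) : (isoG'F' hT M hM).hom ≫ Injective.ι M =
    torδ (shortExact_homδ T M hM) ≫ counitMor (Injective.under M) :=
  (exists_iso_G'_F' hT M hM).choose_spec

/-- The equation is checked after embedding M' in its injective. There `f` extends to a morphism of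
the injective sequences, and naturality of both connecting maps and of the counit applies. -/
lemma isoG'F'_naturality {M M' : FMod.{w} C} (hM : IsZero ((F T).obj M))
    (hM' : IsZero ((F T).obj M')) (f : M ⟶ M') :
    (G' T).map ((F' T).map f) ≫ (isoG'F' hT M' hM').hom = (isoG'F' hT M hM).hom ≫ f := by
  have hS := shortExact_cokernel (Injective.ι M)
  have hS' := shortExact_cokernel (Injective.ι M')
  have : Injective (ShortComplex.mk _ _ (cokernel.condition (Injective.ι M'))).X₂ :=
    Injective.injective_under M'
  obtain ⟨φ, hφ⟩ := exists_hom_of_injective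
    (S' := ShortComplex.mk _ _ (cokernel.condition (Injective.ι M'))) hS f
  have hφ₂ : Injective.ι M ≫ φ.τ₂ = f ≫ Injective.ι M' := by rw [← hφ]; exact φ.comm₁₂.symm
  have n := homδ_naturality T hS hS' φ
  rw [hφ] at n
  let ψ : ShortComplex.mk _ _ (map_comp_homδ T hS) ⟶ ShortComplex.mk _ _ (map_comp_homδ T hS') :=
    { τ₁ := (F T).map φ.τ₂
      τ₂ := (F T).map φ.τ₃
      τ₃ := (F' T).map f
      comm₁₂ := by
        refine ((F T).map_comp _ _).symm.trans (Eq.trans ?_ ((F T).map_comp _ _))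
        exact congrArg (F T).map φ.comm₂₃
      comm₂₃ := n }
  have n' := torδ_naturality (shortExact_homδ T M hM) (shortExact_homδ T M' hM') ψ
  rw [← cancel_mono (Injective.ι M'), Category.assoc, isoG'F'_hom_comp, Category.assoc, ← hφ₂,
    ← Category.assoc (isoG'F' hT M hM).hom, isoG'F'_hom_comp, Category.assoc]
  refine (Category.assoc _ _ _).symm.trans ((congrArg (· ≫ counitMor _) n').trans ?_)
  refine (Category.assoc _ _ _).trans (congrArg (torδ (shortExact_homδ T M hM) ≫ ·) ?_)
  exact counitMor_naturality φ.τ₂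

end TorsionFree

section ClassX

variable (N : FMod.{w} T.FullSubcategory)

omit hT in
lemma shortExact_torδ (hN : IsZero ((G T).obj N)) :
    (ShortComplex.mk _ _ (torδ_comp (shortExact_kernel (cover N)))).ShortExact := by
  have := projective_cover N
  exact
    { exact := exact_of_rep fun c b hb ↦
        exists_comp_torδ (shortExact_kernel (cover N)) (isZero_G'_projective _) b hb
      mono_f := mono_torδ (shortExact_kernel (cover N)) (isZero_G'_projective _)
      epi_g := (exact_map_of_epi (G T) (shortExact_kernel (cover N)).exact).epi_f
        (hN.eq_of_tgt _ _) }

/-- Since F'G = 0, F'G'(N) is the cokernel of FG(K) → FG(P), with P → N the cover and K its kernel.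
The units identify it with the cokernel N of K → P. -/
lemma exists_iso_F'_G' (hN : IsZero ((G T).obj N)) :
    ∃ b : N ≅ (F' T).obj ((G' T).obj N),
      cover N ≫ b.hom = unitMor _ ≫ homδ T (shortExact_torδ N hN) := by
  have hS := shortExact_kernel (cover N)
  have hR := shortExact_torδ N hN
  have := isIso_unit_cover hT N
  have := isIso_unit_kernel_cover hT N
  let S := ShortComplex.mk (kernel.ι (cover N)) (cover N) (kernel.condition _)
  let S' := ShortComplex.mk _ _ (map_comp_homδ T hR)
  have w : kernel.ι (cover N) ≫ unitMor _ ≫ homδ T hR = 0 := by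
    rw [← Category.assoc, ← unitMor_naturality, Category.assoc]
    exact (congrArg (unitMor _ ≫ ·) (map_comp_homδ T hR)).trans comp_zero
  have : Epi S.g := inferInstanceAs (Epi (cover N))
  let φ : S ⟶ S' :=
    { τ₁ := unitMor _
      τ₂ := unitMor _
      τ₃ := hS.exact.desc (unitMor _ ≫ homδ T hR) w
      comm₁₂ := unitMor_naturality (kernel.ι (cover N))
      comm₂₃ := (hS.exact.g_desc _ _).symm }
  have : Epi S'.g := (exact_homδ_F' T hR).epi_f ((isZero_F'_G hT (kernel (cover N))).eq_of_tgt _ _)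
  have : Epi φ.τ₁ := inferInstanceAs (Epi (unitMor (kernel (cover N))))
  have : IsIso φ.τ₂ := isIso_unit_cover hT N
  have := isIso_τ₃ φ (exact_F_homδ T hR)
  exact ⟨asIso φ.τ₃, φ.comm₂₃.symm⟩

/-- For `N` with `N ⊗ T = 0`, the natural isomorphism from `N` to `Ext¹( , Tor₁(N, T))`. -/
def isoF'G' (hN : IsZero ((G T).obj N)) : N ≅ (F' T).obj ((G' T).obj N) :=
  (exists_iso_F'_G' hT N hN).choose

lemma cover_isoF'G'_hom (hN : IsZero ((G T).obj N)) : cover N ≫ (isoF'G' hT N hN).hom =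
    unitMor _ ≫ homδ T (shortExact_torδ N hN) :=
  (exists_iso_F'_G' hT N hN).choose_spec

/-- Dual to `isoG'F'_naturality`: the equation is checked after the cover of N, and `f` lifts to the
covers by projectivity. -/
lemma isoF'G'_naturality {N N' : FMod.{w} T.FullSubcategory} (hN : IsZero ((G T).obj N))
    (hN' : IsZero ((G T).obj N')) (f : N ⟶ N') :
    f ≫ (isoF'G' hT N' hN').hom = (isoF'G' hT N hN).hom ≫ (F' T).map ((G' T).map f) := by
  have hS := shortExact_kernel (cover N)
  have hS' := shortExact_kernel (cover N')
  have : Projective (ShortComplex.mk _ _ (kernel.condition (cover N))).X₂ := projective_cover N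
  obtain ⟨φ, hφ⟩ := exists_hom_of_projective
    (S := ShortComplex.mk _ _ (kernel.condition (cover N))) hS' f
  have hφ₂ : φ.τ₂ ≫ cover N' = cover N ≫ f := by rw [← hφ]; exact φ.comm₂₃
  have n := torδ_naturality hS hS' φ
  rw [hφ] at n
  let ψ : ShortComplex.mk _ _ (torδ_comp hS) ⟶ ShortComplex.mk _ _ (torδ_comp hS') :=
    { τ₁ := (G' T).map f
      τ₂ := (G T).map φ.τ₁
      τ₃ := (G T).map φ.τ₂
      comm₁₂ := n
      comm₂₃ := by
        refine ((G T).map_comp _ _).symm.trans (Eq.trans ?_ ((G T).map_comp _ _))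
        exact congrArg (G T).map φ.comm₁₂ }
  have n' := homδ_naturality T (shortExact_torδ N hN) (shortExact_torδ N' hN') ψ
  rw [← cancel_epi (cover N), ← Category.assoc, ← hφ₂, Category.assoc, cover_isoF'G'_hom,
    ← Category.assoc (cover N), cover_isoF'G'_hom, Category.assoc]
  refine Eq.trans ?_ (congrArg (unitMor _ ≫ ·) n')
  refine (Category.assoc _ _ _).symm.trans (Eq.trans ?_ (Category.assoc _ _ _))
  exact congrArg (· ≫ homδ T (shortExact_torδ N' hN')) (unitMor_naturality φ.τ₂).symm

end ClassX

lemma induceEquivalence_F'_G' {P : ObjectProperty (FMod.{w} C)}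
    {Q : ObjectProperty (FMod.{w} T.FullSubcategory)} (hF : ∀ M, P M → Q ((F' T).obj M))
    (hG : ∀ N, Q N → P ((G' T).obj N)) :
    InduceEquivalence (F' T) (G' T) (torsionFree T ⊓ P) (classX T ⊓ Q) :=
  induceEquivalence_of_isos
    (fun M hM ↦ ⟨isZero_G_F' hT M, hF M hM.2⟩)
    (fun N hN ↦ ⟨torsionFree_iff.2 (isZero_F_G' hT N), hG N hN.2⟩)
    (fun M hM ↦ isoG'F' hT M (torsionFree_iff.1 hM.1))
    (fun hM hM' f ↦ isoG'F'_naturality hT (torsionFree_iff.1 hM.1) (torsionFree_iff.1 hM'.1) f)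
    (fun N hN ↦ isoF'G' hT N hN.1)
    (fun hN hN' f ↦ isoF'G'_naturality hT hN.1 hN'.1 f)

end Tilting

end FunctorTilting

end

theorem mainTheorem2 {C : Type w} [SmallCategory.{w} C] [Preadditive C] [HasFiniteBiproducts C]
    (T : ObjectProperty (FunctorTilting.FMod.{w} C))
    [EssentiallySmall.{w} T.FullSubcategory] [HasFiniteBiproducts T.FullSubcategory]
    (hT : FunctorTilting.IsTilting T)
    (hC : FunctorTilting.HasPseudokernels C)
    (hT' : FunctorTilting.HasPseudokernels T.FullSubcategory) :
    ((∀ M, FunctorTilting.finPres C M →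
        FunctorTilting.finPres T.FullSubcategory ((FunctorTilting.F T).obj M)) ∧
      (∀ M, FunctorTilting.finPres C M →
        FunctorTilting.finPres T.FullSubcategory ((FunctorTilting.F' T).obj M)) ∧
      (∀ N, FunctorTilting.finPres T.FullSubcategory N →
        FunctorTilting.finPres C ((FunctorTilting.G T).obj N)) ∧
      (∀ N, FunctorTilting.finPres T.FullSubcategory N →
        FunctorTilting.finPres C ((FunctorTilting.G' T).obj N))) ∧
    FunctorTilting.InduceEquivalence (FunctorTilting.F T) (FunctorTilting.G T)
      (FunctorTilting.torsion T ⊓ FunctorTilting.finPres C)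
      (FunctorTilting.classY T ⊓ FunctorTilting.finPres T.FullSubcategory) ∧
    FunctorTilting.InduceEquivalence (FunctorTilting.F' T) (FunctorTilting.G' T)
      (FunctorTilting.torsionFree T ⊓ FunctorTilting.finPres C)
      (FunctorTilting.classX T ⊓ FunctorTilting.finPres T.FullSubcategory) ∧
    ((∀ N, IsZero ((FunctorTilting.F T).obj ((FunctorTilting.G' T).obj N))) ∧
      (∀ N, IsZero ((FunctorTilting.F' T).obj ((FunctorTilting.G T).obj N))) ∧
      (∀ M, IsZero ((FunctorTilting.G' T).obj ((FunctorTilting.F T).obj M))) ∧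
      (∀ M, IsZero ((FunctorTilting.G T).obj ((FunctorTilting.F' T).obj M)))) := by
  have : HasBinaryBiproducts C := hasBinaryBiproducts_of_finite_biproducts C
  have : HasBinaryBiproducts T.FullSubcategory := hasBinaryBiproducts_of_finite_biproducts _
  have h₁ : ∀ M, FunctorTilting.finPres C M →
      FunctorTilting.finPres T.FullSubcategory ((FunctorTilting.F T).obj M) := fun M hM ↦
    (FunctorTilting.isCoh_F hT hC hT' (FunctorTilting.isCoh_of_finPres hC hM)).finPres
  have h₂ : ∀ M, FunctorTilting.finPres C M →
      FunctorTilting.finPres T.FullSubcategory ((FunctorTilting.F' T).obj M) := fun M hM ↦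
    (FunctorTilting.isCoh_F' hT hT' hM).finPres
  have h₃ : ∀ N, FunctorTilting.finPres T.FullSubcategory N →
      FunctorTilting.finPres C ((FunctorTilting.G T).obj N) := fun N hN ↦
    (FunctorTilting.isCoh_G hT hC hN).finPres
  have h₄ : ∀ N, FunctorTilting.finPres T.FullSubcategory N →
      FunctorTilting.finPres C ((FunctorTilting.G' T).obj N) := fun N hN ↦
    (FunctorTilting.isCoh_G' hT hC hT' (FunctorTilting.isCoh_of_finPres hT' hN)).finPres
  exact ⟨⟨h₁, h₂, h₃, h₄⟩, FunctorTilting.induceEquivalence_F_G hT h₁ h₃,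
    FunctorTilting.induceEquivalence_F'_G' hT h₂ h₄, FunctorTilting.isZero_F_G' hT,
    FunctorTilting.isZero_F'_G hT, FunctorTilting.isZero_G'_F hT, FunctorTilting.isZero_G_F' hT⟩
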